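/- Setting. Let $\Omega$ be a metric space with its Borel $\sigma$-algebra, $T:\Omega\to\Omega$ a Lipschitz map (for instance a differentiable map with bounded derivative; expansion enters only through the assumptions on cylinders below), and $\mu=\mathbb P$ a $T$-invariant Borel probability measure. For $\Gamma\subset\Omega$ and $\rho>0$ let $B_\rho(\Gamma)=\bigcup_{x\in\Gamma}B_\rho(x)$; for $U\subset\Omega$ let $Z_U^N=\sum_{j=0}^{N-1}\mathbf 1_U\circ T^j$, and put $\mathcal V_\rho^L=\{Z^L_{B_\rho(\Gamma)}\ge1\}$. Cylinders. Fix $R>0$ and, for every $n\ge1$, finitely many points $y_k=y_k^{(n)}$ with $\Omega=\bigcup_kB_R(y_k)$, together with a family of continuous inverse branches $\psi$ of $T^n$ over the balls $B_R(y_k)$, i.e. $T^n\circ\psi=\mathrm{id}$ on $B_R(y_k)$. The sets $\zeta=\psi(B_R(y_k))$ are the $n$-cylinders. Assume that the number of $n$-cylinders meeting a given $n$-cylinder is bounded by a constant independent of the cylinder and of $n$, and that the measures of those balls $B_R(y_k^{(n)})$ that are not null sets are bounded away from $0$ uniformly in $k$ and $n$ (which is automatic if the centres do not depend on $n$). Let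 $J_n$ be a Jacobian of $T^n$ with respect to $\mu$: $\mu(T^nA)=\int_AJ_n\,d\mu$ for all measurable $A$ on which $T^n$ is injective and for which $T^nA$ is measurable. Let $\Gamma\subset\Omega$ with $\mu(\Gamma)=0$, and assume: (I) There is a function $\mathcal C$ with $\mathcal C(k)=O(k^{-\mathfrak p})$ such that $\left|\int G\,(H\circ T^k)\,d\mu-\mu(G)\mu(H)\right|\le\mathcal C(k)\|G\|_{Lip}\|H\|_\infty$ for all $k$, all bounded Lipschitz $G$ and all $H\in L^\infty(\mu)$, where $\|G\|_{Lip}$ is the supremum norm plus the Lipschitz constant. (II) For every $n\ge1$ there is a set $\mathcal G_n$ of $n$-cylinders with union $G_n$ such that: (i) $\mu(G_n^c)\le C n^{-\mathfrak g}$ for some constants $C$ and $\mathfrak g>0$; (ii) $J_n(x)\le C\,\mathfrak D(n)J_n(y)$ for all $x,y\in\zeta$, $\zeta\in\mathcal G_n$, $n\ge1$, where $\mathfrak D$ is non-decreasing and $\mathfrak D(n)=O(n^{\mathfrak d})$ for some $\mathfrak d\ge0$; (iii) $\operatorname{diam}\zeta\le\delta(n)$ for all $\zeta\in\mathcal G_n$,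 where $\delta(n)=O(n^{-\mathfrak k})$ and $\mathfrak k>1$; (iv) $\displaystyle\lim_{L\to\infty}\limsup_{\rho\to0}\sum_{n=L}^\infty\frac{\mu(G_n^c\cap B_\rho(\Gamma)\cap T^{-n}\mathcal V_\rho^L)}{\mu(\mathcal V_\rho^L)}=0$. (III) There are $0<d_0<d_1<\infty$ with $\rho^{d_1}\le\mu(B_\rho(\Gamma))\le\rho^{d_0}$ for all sufficiently small $\rho>0$. (IV) There are $\xi\ge\beta>0$ and $C$ such that $\dfrac{\mu(B_{\rho+r}(\Gamma)\setminus B_{\rho-r}(\Gamma))}{\mu(B_\rho(\Gamma))}\le C\,\dfrac{r^\xi}{\rho^\beta}$ for all sufficiently small $\rho>0$ and all $0<r<\rho$. Assume moreover that $\mathfrak p>\left(\frac\beta\xi+d_1\right)\frac{1+\mathfrak d}{d_0}$ and $\mathfrak k>\frac{1+\mathfrak d}{d_0}$, and that the limits $$\lambda_\ell(L)=\lim_{\rho\to0}\frac{\mathbb P(Z^L_{B_\rho(\Gamma)}=\ell)}{\mathbb P(Z^L_{B_\rho(\Gamma)}\ge1)},\qquad \lambda_\ell=\lim_{L\to\infty}\lambda_\ell(L)$$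 exist, the first one for all sufficiently large $L$ and all $\ell\ge1$, the second one for all $\ell\ge1$. Theorem 1. Under these assumptions $(\lambda_\ell)_{\ell\ge1}$ is a probability distribution and, for every $t>0$ and every integer $k\ge0$, $$\lim_{L\to\infty}\lim_{\rho\to0}\mathbb P\big(Z^{N}_{B_\rho(\Gamma)}=k\big)=\nu(\{k\}),\qquad N=N(L,\rho)=\left\lfloor\frac{tL}{\mathbb P(Z^L_{B_\rho(\Gamma)}\ge1)}\right\rfloor,$$ where the inner limit exists for all sufficiently large $L$, and $\nu$ is the compound Poisson distribution with parameters $t$ and $\lambda_\ell$, i.e. the law of $\sum_{j=1}^PY_j$ with $P$ Poisson distributed with parameter $t$, the $Y_j$ i.i.d. with $\mathbb P(Y_j=\ell)=\lambda_\ell$ for $\ell\ge1$, and $P$ independent of the $Y_j$. -/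

import Mathlib

open MeasureTheory ProbabilityTheory Filter Topology Asymptotics Metric Set
open scoped ENNReal NNReal

noncomputable section

namespace HitStat

/-- `P(S_j = ·)` for the sum `S_j = Y_1 + ... + Y_j` of `j` independent random variables, each with
law `q`. -/
def iidSumLaw (q : PMF ℕ) : ℕ → PMF ℕ
  | 0 => PMF.pure 0
  | j + 1 => (iidSumLaw q j).bind fun s => q.map fun y => s + y

/-- The compound Poisson distribution with parameter `t` and cluster size law `q`: the law of
`Y_1 + ... + Y_P`, where `P` is Poisson with parameter `t`, the `Y_j` are i.i.d. with law `q`, and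
`P` is independent of the `Y_j`. -/
def compoundPoisson (t : ℝ≥0) (q : PMF ℕ) : PMF ℕ :=
  (poissonMeasure t).toPMF.bind fun j => iidSumLaw q j

variable {Ω : Type*}

open Classical in
/-- The hit-counting function `Z_U^N = ∑_{j < N} 1_U ∘ T^j`. -/
def hitCount (T : Ω → Ω) (U : Set Ω) (N : ℕ) (x : Ω) : ℕ :=
  ∑ j ∈ Finset.range N, if T^[j] x ∈ U then 1 else 0

variable [MetricSpace Ω]

/-- `𝒱_ρ^L = {Z^L ≥ 1}`, where the target is the open `ρ`-neighbourhood
`B_ρ(Γ) = ⋃_{x ∈ Γ} B_ρ(x)`. -/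
def hitSet (T : Ω → Ω) (Γ : Set Ω) (ρ : ℝ) (L : ℕ) : Set Ω :=
  {x | 1 ≤ hitCount T (thickening ρ Γ) L x}

/-- `ψ` is a (continuous) inverse branch of `T^n` over the set `B`. -/
def IsInverseBranch (T : Ω → Ω) (n : ℕ) (B : Set Ω) (ψ : Ω → Ω) : Prop :=
  ContinuousOn ψ B ∧ ∀ x ∈ B, T^[n] (ψ x) = x

/-- The `n`-cylinders `ψ(B_R(y))`, where `y` ranges over the finite set `Y n` of centres and `ψ` over
the family `I n y` of inverse branches of `T^n` over `B_R(y)`. -/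
def cylinders (R : ℝ) (Y : ℕ → Finset Ω) (I : ℕ → Ω → Set (Ω → Ω)) (n : ℕ) : Set (Set Ω) :=
  {ζ | ∃ y ∈ Y n, ∃ ψ ∈ I n y, ζ = ψ '' ball y R}

variable [MeasurableSpace Ω]

/-- Standing assumptions on the balls and inverse branches which generate the cylinders. -/
structure CylinderSystem (μ : Measure Ω) (T : Ω → Ω) (R : ℝ) (Y : ℕ → Finset Ω)
    (I : ℕ → Ω → Set (Ω → Ω)) : Prop where
  radius_pos : 0 < R
  cover : ∀ n ≥ 1, ∀ x : Ω, ∃ y ∈ Y n, x ∈ ball y R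
  inverseBranch : ∀ n ≥ 1, ∀ y ∈ Y n, ∀ ψ ∈ I n y, IsInverseBranch T n (ball y R) ψ
  /-- Every `n`-cylinder meets at most `𝔑` of the `n`-cylinders, uniformly in `n`. -/
  overlap : ∃ 𝔑 : ℕ, ∀ n ≥ 1, ∀ ζ ∈ cylinders R Y I n,
    {ζ' ∈ cylinders R Y I n | (ζ ∩ ζ').Nonempty}.encard ≤ (𝔑 : ℕ∞)
  /-- The measures of the generating balls (null balls excepted) are bounded away from zero.
  This is automatic if the centres do not depend on `n`. -/
  ball_lower : ∃ c : ℝ≥0∞, 0 < c ∧ ∀ n ≥ 1, ∀ y ∈ Y n, μ (ball y R) ≠ 0 → c ≤ μ (ball y R)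

/-- `J` is a Jacobian of `S` with respect to `μ`: `μ(S A) = ∫_A J dμ` whenever `S` is injective
on `A`. -/
def IsJacobian (μ : Measure Ω) (S : Ω → Ω) (J : Ω → ℝ≥0) : Prop :=
  Measurable J ∧ ∀ A : Set Ω, MeasurableSet A → InjOn S A → MeasurableSet (S '' A) →
    μ (S '' A) = ∫⁻ x in A, (J x : ℝ≥0∞) ∂μ

/-- Decay of correlations, Lipschitz against bounded functions, with decay function `𝒞`. Here the
Lipschitz norm is the sup norm plus the Lipschitz constant. -/
def DecayOfCorrelations (μ : Measure Ω) (T : Ω → Ω) (𝒞 : ℕ → ℝ) : Prop :=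
  ∀ (k : ℕ) (G H : Ω → ℝ) (K : ℝ≥0) (M B : ℝ),
    LipschitzWith K G → (∀ x, |G x| ≤ M) → AEStronglyMeasurable H μ → (∀ᵐ x ∂μ, |H x| ≤ B) →
      |∫ x, G x * H (T^[k] x) ∂μ - (∫ x, G x ∂μ) * ∫ x, H x ∂μ| ≤ 𝒞 k * (M + K) * B

/-- `𝔊_{ρ,L} = ∑_{n ≥ L} μ(G_n^c ∩ B_ρ(Γ) ∩ T^{-n} 𝒱_ρ^L) / μ(𝒱_ρ^L)`, where `G_n` is the union of
the good `n`-cylinders. -/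
def badReturns (μ : Measure Ω) (T : Ω → Ω) (Γ : Set Ω) (𝒢 : ℕ → Set (Set Ω)) (ρ : ℝ) (L : ℕ) :
    ℝ≥0∞ :=
  ∑' m : ℕ, μ ((⋃₀ 𝒢 (L + m))ᶜ ∩ thickening ρ Γ ∩ T^[L + m] ⁻¹' hitSet T Γ ρ L) /
    μ (hitSet T Γ ρ L)

/-- The assumptions on the families `𝒢 n` of good `n`-cylinders, among all `n`-cylinders `Z n`, with
`J n` the Jacobian of `T^n`. -/
structure GoodCylinders (μ : Measure Ω) (T : Ω → Ω) (Γ : Set Ω) (Z 𝒢 : ℕ → Set (Set Ω))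
    (J : ℕ → Ω → ℝ≥0) (𝔤 𝔡 𝔨 : ℝ) : Prop where
  subset : ∀ n ≥ 1, 𝒢 n ⊆ Z n
  bad_measure : ∃ C : ℝ, ∀ n ≥ 1, μ.real (⋃₀ 𝒢 n)ᶜ ≤ C * (n : ℝ) ^ (-𝔤)
  distortion : ∃ 𝔇 : ℕ → ℝ, Monotone 𝔇 ∧ (𝔇 =O[atTop] fun n : ℕ => (n : ℝ) ^ 𝔡) ∧
    ∃ C : ℝ, ∀ n ≥ 1, ∀ ζ ∈ 𝒢 n, ∀ x ∈ ζ, ∀ y ∈ ζ, (J n x : ℝ) ≤ C * 𝔇 n * (J n y : ℝ)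
  contraction : ∃ δ : ℕ → ℝ, (δ =O[atTop] fun n : ℕ => (n : ℝ) ^ (-𝔨)) ∧
    ∀ n ≥ 1, ∀ ζ ∈ 𝒢 n, ∀ x ∈ ζ, ∀ y ∈ ζ, dist x y ≤ δ n
  bad_returns : Tendsto (fun L : ℕ => limsup (fun ρ : ℝ => badReturns μ T Γ 𝒢 ρ L) (𝓝[>] 0))
    atTop (𝓝 0)

/-- Dimension estimate, for all sufficiently small `ρ`. -/
def DimensionEstimate (μ : Measure Ω) (Γ : Set Ω) (d₀ d₁ : ℝ) : Prop :=
  ∀ᶠ ρ : ℝ in 𝓝[>] 0, ρ ^ d₁ ≤ μ.real (thickening ρ Γ) ∧ μ.real (thickening ρ Γ) ≤ ρ ^ d₀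

/-- Annulus condition, for all sufficiently small `ρ` and all `0 < r < ρ`. -/
def AnnulusCondition (μ : Measure Ω) (Γ : Set Ω) (ξ β : ℝ) : Prop :=
  ∃ C : ℝ, ∀ᶠ ρ : ℝ in 𝓝[>] 0, ∀ r : ℝ, 0 < r → r < ρ →
    μ.real (thickening (ρ + r) Γ \ thickening (ρ - r) Γ) / μ.real (thickening ρ Γ) ≤
      C * (r ^ ξ / ρ ^ β)

end HitStat

end

/-! Write `U = B_ρ(Γ)` and `p = P(Z^L ≥ 1)`. The time `tL/p` consists of about `K = t/p` blocks of
length `L`. If the blocks were independent, the number of hits would be a sum of `K` i.i.d. block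
counts, each zero with probability `1 - p` and with conditional cluster law tending to `λ(L)` as `ρ
→ 0`. Since `K p → t`, this compound binomial law tends to the compound Poisson law with parameters
`t` and `λ(L)`, and then `L → ∞`.

Independence costs, per block, a hit in the gap `D` after a block with a hit, plus a mixing error.
With `K` of order `1/p`, each cost must be small relative to `p`. Mixing (`exists_mixing_rate`)
comes from replacing the indicator of `{Z^L = ℓ}` by a Lipschitz function: the annulus condition
controls the replacement, and decay of correlations over a gap of order `ρ^(-v)` beats the Lipschitz
norm. Short returns (`eventually_short_returns_le`) come from the cylinders. Distortion and
contraction bound the good part of `μ(U ∩ T⁻ⁿ V)` by a constant times `n^𝔡 (ρ + n^(-𝔨))^d₀ μ(V)`,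
with `V` the set of points hitting `U` within `g` steps. Summed over `g ≤ n ≤ ρ^(-v)` this is a
small multiple of `μ(V)`. Separated blocks of length `g` are therefore rarely hit together, so the
probability of a hit grows linearly in the window length, whereas hits in two successive windows
remain comparatively rare.

Linear growth also bounds the mean cluster size, `L μ(U) ≤ C p`. Hence no mass of `λ(L)` escapes to
infinity and `λ` has total mass one. Existence of the inner limit is subtler, because for fixed `L`
the block argument only gives an approximation. In `compoundPoisson_limit` time is measured in units
of `1/μ(U)`, which do not involve `L`: letting `L` run through an ultrafilter identifies the limit
law on that scale, and `L μ(U)/p` converges to the mean of `λ(L)`, which converts it back to the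
scale `tL/p`. -/

noncomputable section

namespace HitStat

/-! ### Hits in time windows and separated blocks -/

section HitCounts

variable {Ω : Type*}

/-- The set of points whose orbit enters `U` before time `n`. -/
def hit (T : Ω → Ω) (U : Set Ω) (n : ℕ) : Set Ω := {x | 1 ≤ hitCount T U n x}

theorem hitCount_add (T : Ω → Ω) (U : Set Ω) (m n : ℕ) (x : Ω) :
    hitCount T U (m + n) x = hitCount T U m x + hitCount T U n (T^[m] x) := by
  simp only [hitCount, Finset.sum_range_add]
  congr 1
  refine Finset.sum_congr rfl fun j _ => ?_
  rw [add_comm m j, Function.iterate_add_apply]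

theorem mem_hit {T : Ω → Ω} {U : Set Ω} {n : ℕ} {x : Ω} :
    x ∈ hit T U n ↔ ∃ j < n, T^[j] x ∈ U := by
  simp only [hit, hitCount, mem_ofPred_eq, Nat.one_le_iff_ne_zero, ne_eq, Finset.sum_eq_zero_iff,
    Finset.mem_range, not_forall]
  constructor
  · rintro ⟨j, hj, h⟩
    exact ⟨j, hj, by by_contra h'; simp [h'] at h⟩
  · rintro ⟨j, hj, h⟩
    exact ⟨j, hj, by simp [h]⟩

theorem hitCount_eq_zero_iff {T : Ω → Ω} {U : Set Ω} {n : ℕ} {x : Ω} :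
    hitCount T U n x = 0 ↔ x ∉ hit T U n := by
  simp [hit, Nat.one_le_iff_ne_zero]

theorem hit_mono (T : Ω → Ω) (U : Set Ω) {m n : ℕ} (h : m ≤ n) : hit T U m ⊆ hit T U n := by
  intro x hx
  obtain ⟨j, hj, hU⟩ := mem_hit.1 hx
  exact mem_hit.2 ⟨j, hj.trans_le h, hU⟩

theorem hit_add (T : Ω → Ω) (U : Set Ω) (m n : ℕ) :
    hit T U (m + n) = hit T U m ∪ T^[m] ⁻¹' hit T U n := by
  ext x
  simp only [hit, mem_ofPred_eq, hitCount_add, mem_union, mem_preimage]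
  omega

theorem subset_hit (T : Ω → Ω) (U : Set Ω) {n : ℕ} (hn : 1 ≤ n) : U ⊆ hit T U n :=
  fun _ hx => mem_hit.2 ⟨0, hn, hx⟩

theorem hitCount_le (T : Ω → Ω) (U : Set Ω) (n : ℕ) (x : Ω) : hitCount T U n x ≤ n := by
  classical
  calc hitCount T U n x ≤ ∑ _j ∈ Finset.range n, 1 := by
        unfold hitCount
        exact Finset.sum_le_sum fun j _ => by split_ifs <;> simp
    _ = n := by simp

/-- Truncated subtraction keeps this valid for `M < D`, where both counts are zero; thus no lower
bound on the length of the future is needed later. -/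
theorem hitCount_eq_of_notMem_hit {T : Ω → Ω} {U : Set Ω} {D : ℕ} {x : Ω} (hx : x ∉ hit T U D) (M : ℕ) :
    hitCount T U M x = hitCount T U (M - D) (T^[D] x) := by
  rcases le_total D M with h | h
  · conv_lhs => rw [← Nat.add_sub_cancel' h]
    rw [hitCount_add, hitCount_eq_zero_iff.2 hx, zero_add]
  · have : x ∉ hit T U M := fun h' => hx (hit_mono T U h h')
    rw [hitCount_eq_zero_iff.2 this, Nat.sub_eq_zero_of_le h]
    simp [hitCount]

variable [MeasurableSpace Ω] {μ : Measure Ω} {T : Ω → Ω} {U : Set Ω}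

theorem measurable_hitCount (hT : Measurable T) (hU : MeasurableSet U) (n : ℕ) :
    Measurable (hitCount T U n) := by
  unfold hitCount
  refine Finset.measurable_sum _ fun j _ => ?_
  exact Measurable.ite ((hT.iterate j) hU) measurable_const measurable_const

theorem measurableSet_hitCount_eq (hT : Measurable T) (hU : MeasurableSet U) (n k : ℕ) :
    MeasurableSet {x | hitCount T U n x = k} :=
  measurable_hitCount hT hU n (measurableSet_singleton k)

theorem measurableSet_hit (hT : Measurable T) (hU : MeasurableSet U) (n : ℕ) :
    MeasurableSet (hit T U n) :=
  measurable_hitCount hT hU n (measurableSet_Ici (a := 1))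

theorem measureReal_preimage_iterate (hT : MeasurePreserving T μ μ) (n : ℕ) {A : Set Ω}
    (hA : MeasurableSet A) : μ.real (T^[n] ⁻¹' A) = μ.real A := by
  simp only [Measure.real, (hT.iterate n).measure_preimage hA.nullMeasurableSet]

variable [IsProbabilityMeasure μ]

theorem measureReal_hit_le (hT : MeasurePreserving T μ μ) (hU : MeasurableSet U) (n : ℕ) :
    μ.real (hit T U n) ≤ n * μ.real U := by
  have h : hit T U n ⊆ ⋃ j ∈ Finset.range n, T^[j] ⁻¹' U := by
    intro x hx
    obtain ⟨j, hj, hU⟩ := mem_hit.1 hx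
    simp only [mem_iUnion, Finset.mem_range]
    exact ⟨j, hj, hU⟩
  calc μ.real (hit T U n) ≤ μ.real (⋃ j ∈ Finset.range n, T^[j] ⁻¹' U) := measureReal_mono h (measure_ne_top _ _)
    _ ≤ ∑ j ∈ Finset.range n, μ.real (T^[j] ⁻¹' U) := measureReal_biUnion_finset_le _ _
    _ = n * μ.real U := by simp [measureReal_preimage_iterate hT _ hU]

theorem measureReal_le_hit (T : Ω → Ω) {n : ℕ} (hn : 1 ≤ n) :
    μ.real U ≤ μ.real (hit T U n) := measureReal_mono (subset_hit T U hn)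

/-- Separated returns to a block of length `g` are controlled by the correlations of `U` with later
blocks of length `g`. -/
theorem measureReal_hit_inter_le_sum (hT : MeasurePreserving T μ μ) (hU : MeasurableSet U)
    {g D W : ℕ} (hg : 1 ≤ g) (hW : 2 * g + D ≤ W) :
    μ.real (hit T U g ∩ T^[2 * g] ⁻¹' hit T U D) ≤
      ∑ n ∈ Finset.Icc g W, μ.real (U ∩ T^[n] ⁻¹' hit T U g) := by
  -- Here `c i = ⌈i/g⌉ g - i`. For a first hit at `j < g` and a later hit in the block starting at
  -- `b g`, the delay `i = b g - j` determines `j = c i`. A union over delays alone therefore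
  -- suffices, and no factor `g` is lost.
  set c : ℕ → ℕ := fun i => (i + (g - 1)) / g * g - i
  have hsub : hit T U g ∩ T^[2 * g] ⁻¹' hit T U D ⊆
      ⋃ i ∈ Finset.Icc g W, T^[c i] ⁻¹' (U ∩ T^[i] ⁻¹' hit T U g) := by
    rintro x ⟨h1, h2⟩
    obtain ⟨j, hj, hjU⟩ := mem_hit.1 h1
    obtain ⟨h, hh, hhU⟩ := mem_hit.1 h2
    rw [← Function.iterate_add_apply] at hhU
    set b := (h + 2 * g) / g with hb
    have hb2 : 2 ≤ b := by
      rw [hb, Nat.le_div_iff_mul_le hg]; omega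
    have hbg : b * g ≤ h + 2 * g := Nat.div_mul_le_self _ _
    have hbg' : h + 2 * g - b * g < g := by
      have := Nat.div_add_mod (h + 2 * g) g
      have h3 := Nat.mod_lt (h + 2 * g) hg
      rw [← hb, mul_comm] at this
      omega
    have h2g : 2 * g ≤ b * g := Nat.mul_le_mul_right g hb2
    have hci : c (b * g - j) = j := by
      have : (b * g - j + (g - 1)) / g = b := by
        apply Nat.div_eq_of_lt_le
        · omega
        · rw [Nat.succ_mul]; omega
      simp only [c, this]
      omega
    simp only [mem_iUnion]
    refine ⟨b * g - j, Finset.mem_Icc.2 ⟨by omega, by omega⟩, ?_⟩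
    rw [hci]
    refine ⟨hjU, ?_⟩
    simp only [mem_preimage]
    rw [← Function.iterate_add_apply, Nat.sub_add_cancel (by omega)]
    refine mem_hit.2 ⟨h + 2 * g - b * g, hbg', ?_⟩
    rw [← Function.iterate_add_apply, Nat.sub_add_cancel hbg]
    exact hhU
  have hm : ∀ i, MeasurableSet (U ∩ T^[i] ⁻¹' hit T U g) := fun i =>
    hU.inter ((hT.measurable.iterate i) (measurableSet_hit hT.measurable hU g))
  calc _ ≤ _ := measureReal_mono hsub (measure_ne_top _ _)
    _ ≤ _ := measureReal_biUnion_finset_le _ _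
    _ = _ := Finset.sum_congr rfl fun i _ => measureReal_preimage_iterate hT _ (hm i)

/-- Inclusion–exclusion for the first `g` steps and the `L` steps from time `2g` on, both of which
lie in the long window. -/
theorem measureReal_hit_add_ge (hT : MeasurePreserving T μ μ) (hU : MeasurableSet U) (g L : ℕ) :
    μ.real (hit T U L) + μ.real (hit T U g) - μ.real (hit T U g ∩ T^[2 * g] ⁻¹' hit T U L) ≤
      μ.real (hit T U (2 * g + L)) := by
  have hmL := measurableSet_hit hT.measurable hU L
  have hm2 : MeasurableSet (T^[2 * g] ⁻¹' hit T U L) := (hT.measurable.iterate _) hmL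
  have h1 : μ.real (hit T U g \ T^[2 * g] ⁻¹' hit T U L ∪ T^[2 * g] ⁻¹' hit T U L) =
      μ.real (hit T U g \ T^[2 * g] ⁻¹' hit T U L) + μ.real (T^[2 * g] ⁻¹' hit T U L) :=
    measureReal_union disjoint_sdiff_left hm2
  have h2 := measureReal_inter_add_sdiff (μ := μ) (s := hit T U g) hm2
  have h3 : μ.real (hit T U g \ T^[2 * g] ⁻¹' hit T U L ∪ T^[2 * g] ⁻¹' hit T U L) ≤
      μ.real (hit T U (2 * g + L)) := by
    refine measureReal_mono ?_ (measure_ne_top _ _)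
    rw [hit_add]
    exact union_subset_union_left _ (sdiff_subset.trans (hit_mono T U (by omega)))
  rw [measureReal_preimage_iterate hT _ hmL] at h1
  linarith

/-- Each extension by `2g` steps contributes a new block of length `g`, and at most half of its
probability is lost to overlap with the later hits. -/
theorem measureReal_hit_linear_growth (hT : MeasurePreserving T μ μ) (hU : MeasurableSet U)
    {g D : ℕ} (h : μ.real (hit T U g ∩ T^[2 * g] ⁻¹' hit T U D) ≤ μ.real (hit T U g) / 2) (m : ℕ)
    (hm : 2 * g * m ≤ D) : m / 2 * μ.real (hit T U g) ≤ μ.real (hit T U (2 * g * m)) := by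
  induction m with
  | zero => simp
  | succ m ih =>
    rw [Nat.mul_succ] at hm
    have h1 := measureReal_hit_add_ge (μ := μ) hT hU g (2 * g * m)
    have h2 : μ.real (hit T U g ∩ T^[2 * g] ⁻¹' hit T U (2 * g * m)) ≤
        μ.real (hit T U g ∩ T^[2 * g] ⁻¹' hit T U D) :=
      measureReal_mono (inter_subset_inter_right _ (preimage_mono (hit_mono T U (by omega))))
    rw [Nat.mul_succ, add_comm (2 * g * m)]
    have := ih (by omega)
    push_cast
    linarith

/-- Hits in the `2g` steps after time `L` are paid for outright. Any later hit comes at least `2g`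
after the start of the `g`-block containing the earlier hit, so it is a separated return for one of
at most `L/g + 1` blocks. -/
theorem measureReal_hit_inter_next_le (hT : MeasurePreserving T μ μ) (hU : MeasurableSet U)
    {g : ℕ} (hg : 1 ≤ g) (L D : ℕ) :
    μ.real (hit T U L ∩ T^[L] ⁻¹' hit T U D) ≤ 2 * μ.real (hit T U g) +
      (L / g + 1) * μ.real (hit T U g ∩ T^[2 * g] ⁻¹' hit T U (L + D)) := by
  set A := hit T U g ∩ T^[2 * g] ⁻¹' hit T U (L + D)
  have hmA : MeasurableSet A := (measurableSet_hit hT.measurable hU g).inter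
    ((hT.measurable.iterate _) (measurableSet_hit hT.measurable hU _))
  have hsub : hit T U L ∩ T^[L] ⁻¹' hit T U D ⊆ (T^[L] ⁻¹' hit T U (g + g)) ∪
      ⋃ i ∈ Finset.range (L / g + 1), T^[i * g] ⁻¹' A := by
    rintro x ⟨h1, h2⟩
    have h2' : T^[L] x ∈ hit T U (2 * g + D) := hit_mono T U (by omega) h2
    rw [hit_add] at h2'
    rcases h2' with h3 | h3
    · left
      rwa [← two_mul]
    right
    obtain ⟨j, hj, hjU⟩ := mem_hit.1 h1
    obtain ⟨h, hh, hhU⟩ := mem_hit.1 h3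
    rw [← Function.iterate_add_apply, ← Function.iterate_add_apply] at hhU
    have hjg : j / g * g ≤ j := Nat.div_mul_le_self _ _
    have hjg' : j - j / g * g < g := by
      have := Nat.div_add_mod j g
      have h3 := Nat.mod_lt j hg
      rw [mul_comm] at this
      omega
    simp only [mem_iUnion, Finset.mem_range]
    refine ⟨j / g, Nat.lt_succ_of_le (Nat.div_le_div_right hj.le), ?_, ?_⟩
    · refine mem_hit.2 ⟨j - j / g * g, hjg', ?_⟩
      rwa [← Function.iterate_add_apply, Nat.sub_add_cancel hjg]
    · refine mem_hit.2 ⟨h + L - j / g * g, by omega, ?_⟩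
      rw [← Function.iterate_add_apply, ← Function.iterate_add_apply]
      convert hhU using 2
      omega
  have hmg := measurableSet_hit hT.measurable hU g
  have h2g : μ.real (T^[L] ⁻¹' hit T U (g + g)) ≤ 2 * μ.real (hit T U g) := by
    rw [measureReal_preimage_iterate hT _ (measurableSet_hit hT.measurable hU _), hit_add]
    refine (measureReal_union_le _ _).trans ?_
    rw [measureReal_preimage_iterate hT _ hmg]
    linarith
  calc _ ≤ _ := measureReal_mono hsub (measure_ne_top _ _)
    _ ≤ _ := measureReal_union_le _ _
    _ ≤ 2 * μ.real (hit T U g) + ∑ i ∈ Finset.range (L / g + 1), μ.real (T^[i * g] ⁻¹' A) :=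
      add_le_add h2g (measureReal_biUnion_finset_le _ _)
    _ = 2 * μ.real (hit T U g) + ((L / g : ℕ) + 1 : ℝ) * μ.real A := by
      simp [measureReal_preimage_iterate hT _ hmA]
    _ ≤ _ := by
      gcongr
      exact Nat.cast_div_le

end HitCounts

/-! ### Compound binomial and compound Poisson laws as power series coefficients -/

section CompoundPoissonSeries

open PowerSeries

/-- The generating series `∑_{ℓ ≥ 1} f ℓ X^ℓ`. -/
def clusterSeries (f : ℕ → ℝ) : ℝ⟦X⟧ := PowerSeries.mk fun ℓ => if ℓ = 0 then 0 else f ℓ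

/-- The coefficient of `X^k` in `exp (t (∑_{ℓ ≥ 1} f ℓ X^ℓ - 1))`. -/
def compoundPoissonCoeff (t : ℝ) (f : ℕ → ℝ) (k : ℕ) : ℝ :=
  ∑ j ∈ Finset.range (k + 1),
    Real.exp (-t) * t ^ j / j.factorial * coeff k (clusterSeries f ^ j)

/-- Every cluster has at least one point, so `k` points come from at most `k` clusters. All sums
over the number of clusters become finite, and pointwise convergence of the cluster laws is enough.
-/
theorem coeff_clusterSeries_pow_eq_zero (f : ℕ → ℝ) {j k : ℕ} (h : k < j) :
    coeff k (clusterSeries f ^ j) = 0 := by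
  have hX : (X : ℝ⟦X⟧) ∣ clusterSeries f := X_dvd_iff.2 (by simp [clusterSeries])
  exact X_pow_dvd_iff.1 (pow_dvd_pow_of_dvd hX j) k h

theorem tendsto_coeff_clusterSeries_pow {ι : Type*} {l : Filter ι} {F : ι → ℕ → ℝ} {f : ℕ → ℝ}
    (h : ∀ ℓ ≥ 1, Tendsto (fun i => F i ℓ) l (𝓝 (f ℓ))) (j k : ℕ) :
    Tendsto (fun i => coeff k (clusterSeries (F i) ^ j)) l (𝓝 (coeff k (clusterSeries f ^ j))) := by
  induction j generalizing k with
  | zero => simpa using tendsto_const_nhds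
  | succ j ih =>
    simp only [pow_succ, coeff_mul]
    refine tendsto_finsetSum _ fun x _ => (ih x.1).mul ?_
    simp only [clusterSeries, coeff_mk]
    by_cases hx : x.2 = 0
    · simpa [hx] using tendsto_const_nhds
    · simpa [hx] using h x.2 (Nat.one_le_iff_ne_zero.2 hx)

theorem tendsto_compoundPoissonCoeff {ι : Type*} {l : Filter ι} {F : ι → ℕ → ℝ} {f : ℕ → ℝ}
    {s : ι → ℝ} {t : ℝ} (hs : Tendsto s l (𝓝 t))
    (h : ∀ ℓ ≥ 1, Tendsto (fun i => F i ℓ) l (𝓝 (f ℓ))) (k : ℕ) :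
    Tendsto (fun i => compoundPoissonCoeff (s i) (F i) k) l (𝓝 (compoundPoissonCoeff t f k)) := by
  refine tendsto_finsetSum _ fun j _ => Tendsto.mul ?_ (tendsto_coeff_clusterSeries_pow h j k)
  exact (((Real.continuous_exp.tendsto _).comp hs.neg).mul (hs.pow j)).div_const _

/-- The binomial expansion runs over `j ≤ K`; truncating at `k` instead makes the number of terms
independent of `K`, so that the limit can be taken term by term. Both truncations agree with the one
at `max K k`. -/
theorem coeff_binomial_clusterSeries (p : ℝ) (f : ℕ → ℝ) (K k : ℕ) :
    coeff k ((C (1 - p) + C p * clusterSeries f) ^ K) = ∑ j ∈ Finset.range (k + 1),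
      K.choose j * p ^ j * (1 - p) ^ (K - j) * coeff k (clusterSeries f ^ j) := by
  have h1 : ∀ j, coeff k ((C p * clusterSeries f) ^ j * C (1 - p) ^ (K - j) * (K.choose j : ℝ⟦X⟧)) =
      K.choose j * p ^ j * (1 - p) ^ (K - j) * coeff k (clusterSeries f ^ j) := by
    intro j
    have : (C p * clusterSeries f) ^ j * C (1 - p) ^ (K - j) * (K.choose j : ℝ⟦X⟧) =
        C (K.choose j * p ^ j * (1 - p) ^ (K - j)) * clusterSeries f ^ j := by
      simp only [mul_pow, map_mul, map_pow, map_natCast]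
      ring
    rw [this, coeff_C_mul]
  rw [add_comm, add_pow, map_sum, Finset.sum_congr rfl fun j _ => h1 j]
  have hA : ∀ n ≥ K, ∑ j ∈ Finset.range (K + 1),
      (K.choose j * p ^ j * (1 - p) ^ (K - j) * coeff k (clusterSeries f ^ j) : ℝ) =
      ∑ j ∈ Finset.range (n + 1),
      (K.choose j * p ^ j * (1 - p) ^ (K - j) * coeff k (clusterSeries f ^ j) : ℝ) := by
    intro n hn
    refine Finset.sum_subset (Finset.range_mono (by omega)) fun j _ hj => ?_
    rw [Nat.choose_eq_zero_of_lt (by simpa using hj)]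
    simp
  have hB : ∀ n ≥ k, ∑ j ∈ Finset.range (k + 1),
      (K.choose j * p ^ j * (1 - p) ^ (K - j) * coeff k (clusterSeries f ^ j) : ℝ) =
      ∑ j ∈ Finset.range (n + 1),
      (K.choose j * p ^ j * (1 - p) ^ (K - j) * coeff k (clusterSeries f ^ j) : ℝ) := by
    intro n hn
    refine Finset.sum_subset (Finset.range_mono (by omega)) fun j _ hj => ?_
    rw [coeff_clusterSeries_pow_eq_zero f (by simpa using hj)]
    simp
  rw [hA (max K k) (le_max_left _ _), hB (max K k) (le_max_right _ _)]

theorem tendsto_binomial_poisson {ι : Type*} {l : Filter ι} {K : ι → ℕ} {p : ι → ℝ} {t : ℝ}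
    (hK : Tendsto K l atTop) (hp : Tendsto (fun i => K i * p i) l (𝓝 t)) (j : ℕ) :
    Tendsto (fun i => (K i).choose j * p i ^ j * (1 - p i) ^ (K i - j)) l
      (𝓝 (Real.exp (-t) * t ^ j / j.factorial)) := by
  have hKr : Tendsto (fun i => (K i : ℝ)) l atTop := tendsto_natCast_atTop_atTop.comp hK
  have hp0 : Tendsto p l (𝓝 0) := by
    have h := hp.mul (tendsto_inv_atTop_zero.comp hKr)
    rw [mul_zero] at h
    refine h.congr' ?_
    filter_upwards [hK.eventually_ge_atTop 1] with i hi
    have : (K i : ℝ) ≠ 0 := by positivity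
    simp only [Function.comp]
    field_simp
  have h1 : Tendsto (fun i => ((K i).choose j : ℝ) * p i ^ j) l (𝓝 (t ^ j / j.factorial)) := by
    have he : (fun i => ((K i).choose j : ℝ) * p i ^ j) ~[l]
        fun i => (K i * p i) ^ j / j.factorial := by
      have := ((isEquivalent_choose j).comp_tendsto hK).mul
        (IsEquivalent.refl (u := fun i => p i ^ j) (l := l))
      refine this.trans (EventuallyEq.isEquivalent (.of_eq ?_))
      ext i
      simp only [Pi.mul_apply, Function.comp]
      ring
    exact he.tendsto_nhds_iff.2 ((hp.pow j).div_const _)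
  have hsmall : ∀ᶠ i in l, p i < 1 / 2 := hp0.eventually (Iio_mem_nhds (by norm_num))
  have h2 : Tendsto (fun i => (1 - p i) ^ K i) l (𝓝 (Real.exp (-t))) := by
    -- Squeeze by `-p/(1-p) ≤ log (1-p) ≤ -p`.
    have hlog : Tendsto (fun i => K i * Real.log (1 - p i)) l (𝓝 (-t)) := by
      have hlow : Tendsto (fun i => -(K i * p i) * (1 - p i)⁻¹) l (𝓝 (-t)) := by
        have := hp.neg.mul (((tendsto_const_nhds (x := (1 : ℝ))).sub hp0).inv₀ (by norm_num))
        simpa using this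
      refine tendsto_of_tendsto_of_tendsto_of_le_of_le' hlow hp.neg ?_ ?_
      · filter_upwards [hsmall] with i hi
        have h0 : 0 < 1 - p i := by linarith
        have := Real.one_sub_inv_le_log_of_pos h0
        have h3 : 1 - (1 - p i)⁻¹ = -p i * (1 - p i)⁻¹ := by field_simp; ring
        rw [h3] at this
        calc -(K i * p i) * (1 - p i)⁻¹ = K i * (-p i * (1 - p i)⁻¹) := by ring
          _ ≤ _ := by gcongr
      · filter_upwards [hsmall] with i hi
        have h0 : 0 < 1 - p i := by linarith
        have := Real.log_le_sub_one_of_pos h0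
        calc K i * Real.log (1 - p i) ≤ K i * (1 - p i - 1) := by gcongr
          _ = _ := by ring
    refine ((Real.continuous_exp.tendsto _).comp hlog).congr' ?_
    filter_upwards [hsmall] with i hi
    have h0 : 0 < 1 - p i := by linarith
    simp only [Function.comp]
    rw [mul_comm, Real.exp_mul, Real.exp_log h0, Real.rpow_natCast]
  have h3 : Tendsto (fun i => ((1 - p i) ^ j)⁻¹) l (𝓝 1) := by
    have := (((tendsto_const_nhds (x := (1 : ℝ))).sub hp0).pow j).inv₀ (by norm_num)
    simpa using this
  have h4 := (h1.mul (h2.mul h3))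
  have : t ^ j / j.factorial * (Real.exp (-t) * 1) = Real.exp (-t) * t ^ j / j.factorial := by ring
  rw [this] at h4
  refine h4.congr' ?_
  filter_upwards [hsmall, hK.eventually_ge_atTop j] with i hi hj
  have h0 : 1 - p i ≠ 0 := by linarith
  rw [pow_sub₀ _ h0 hj]

/-- Convergence of compound binomial to compound Poisson coefficients. -/
theorem tendsto_coeff_binomial_clusterSeries {ι : Type*} {l : Filter ι} {K : ι → ℕ} {p : ι → ℝ}
    {t : ℝ} {F : ι → ℕ → ℝ} {f : ℕ → ℝ} (hK : Tendsto K l atTop)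
    (hp : Tendsto (fun i => K i * p i) l (𝓝 t))
    (h : ∀ ℓ ≥ 1, Tendsto (fun i => F i ℓ) l (𝓝 (f ℓ))) (k : ℕ) :
    Tendsto (fun i => coeff k ((C (1 - p i) + C (p i) * clusterSeries (F i)) ^ K i)) l
      (𝓝 (compoundPoissonCoeff t f k)) := by
  simp only [coeff_binomial_clusterSeries]
  exact tendsto_finsetSum _ fun j _ =>
    (tendsto_binomial_poisson hK hp j).mul (tendsto_coeff_clusterSeries_pow h j k)

/-- A sequence of laws that almost satisfies the recursion of the convolution powers of `φ` stays
close to these powers. -/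
theorem abs_sub_coeff_pow_le {φ : ℝ⟦X⟧} {k₀ : ℕ} {η : ℝ} {a : ℕ → ℕ → ℝ}
    (hφ : ∀ ℓ, 0 ≤ coeff ℓ φ) (hφ1 : ∑ ℓ ∈ Finset.range (k₀ + 1), coeff ℓ φ ≤ 1) (hη : 0 ≤ η)
    (h0 : ∀ k, a 0 k = if k = 0 then 1 else 0)
    (hrec : ∀ m, ∀ k ≤ k₀, |a (m + 1) k -
      ∑ x ∈ Finset.HasAntidiagonal.antidiagonal k, coeff x.1 φ * a m x.2| ≤ η)
    (m : ℕ) {k : ℕ} (hk : k ≤ k₀) : |a m k - coeff k (φ ^ m)| ≤ m * η := by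
  induction m generalizing k with
  | zero => simp [h0, coeff_one]
  | succ m ih =>
    have h1 : |∑ x ∈ Finset.HasAntidiagonal.antidiagonal k, coeff x.1 φ * a m x.2 - coeff k (φ ^ (m + 1))| ≤
        m * η := by
      rw [pow_succ', coeff_mul, ← Finset.sum_sub_distrib]
      refine (Finset.abs_sum_le_sum_abs _ _).trans ?_
      calc _ ≤ ∑ x ∈ Finset.HasAntidiagonal.antidiagonal k, coeff x.1 φ * (m * η) := by
            refine Finset.sum_le_sum fun x hx => ?_
            rw [← mul_sub, abs_mul, abs_of_nonneg (hφ _)]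
            have : x.2 ≤ k := by
              have := Finset.HasAntidiagonal.mem_antidiagonal.1 hx
              omega
            exact mul_le_mul_of_nonneg_left (ih (this.trans hk)) (hφ _)
        _ = (∑ ℓ ∈ Finset.range (k + 1), coeff ℓ φ) * (m * η) := by
            rw [← Finset.sum_mul, Finset.Nat.sum_antidiagonal_eq_sum_range_succ
              (fun i _ => coeff i φ)]
        _ ≤ 1 * (m * η) := by
            refine mul_le_mul_of_nonneg_right (le_trans ?_ hφ1) (by positivity)
            exact Finset.sum_le_sum_of_subset_of_nonneg (Finset.range_mono (by omega))
              fun _ _ _ => hφ _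
        _ = _ := one_mul _
    have h2 := hrec m k hk
    push_cast
    calc |a (m + 1) k - coeff k (φ ^ (m + 1))| ≤ _ := abs_sub_le _ _ _
      _ ≤ _ := add_le_add h2 h1
      _ = _ := by ring

/-- Since `q 0 = 0`, the series `clusterSeries f` is the generating function of `q`, and adding an
independent variable multiplies generating functions. -/
theorem toReal_iidSumLaw (q : PMF ℕ) (hq : q 0 = 0) (f : ℕ → ℝ) (hf : ∀ ℓ ≥ 1, (q ℓ).toReal = f ℓ)
    (j k : ℕ) : (iidSumLaw q j k).toReal = coeff k (clusterSeries f ^ j) := by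
  induction j generalizing k with
  | zero =>
    simp only [iidSumLaw, pow_zero, coeff_one, PMF.pure_apply]
    split_ifs <;> simp
  | succ j ih =>
    have hq' : ∀ ℓ, (q ℓ).toReal = coeff ℓ (clusterSeries f) := by
      intro ℓ
      simp only [clusterSeries, coeff_mk]
      split_ifs with h
      · simp [h, hq]
      · exact hf ℓ (Nat.one_le_iff_ne_zero.2 h)
    have hmap : ∀ s, (q.map fun y => s + y) k = if s ≤ k then q (k - s) else 0 := by
      intro s
      rw [PMF.map_apply]
      split_ifs with h
      · rw [tsum_eq_single (k - s)]
        · simp [Nat.add_sub_cancel' h]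
        · intro b hb
          rw [if_neg (by omega)]
      · refine ENNReal.tsum_eq_zero.2 fun b => ?_
        rw [if_neg (by omega)]
    rw [iidSumLaw, PMF.bind_apply, tsum_eq_sum (s := Finset.range (k + 1)), ENNReal.toReal_sum,
      pow_succ, coeff_mul, Finset.Nat.sum_antidiagonal_eq_sum_range_succ
        (fun a b => coeff a (clusterSeries f ^ j) * coeff b (clusterSeries f))]
    · refine Finset.sum_congr rfl fun s hs => ?_
      rw [hmap, if_pos (by simpa [Nat.lt_succ_iff] using hs), ENNReal.toReal_mul, ih, hq']
    · intro s _
      exact ENNReal.mul_ne_top (PMF.apply_ne_top _ _) (PMF.apply_ne_top _ _)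
    · intro s hs
      rw [hmap, if_neg (by simpa [Nat.lt_succ_iff] using hs), mul_zero]

theorem toReal_compoundPoisson (t : ℝ≥0) (q : PMF ℕ) (hq : q 0 = 0) (f : ℕ → ℝ)
    (hf : ∀ ℓ ≥ 1, (q ℓ).toReal = f ℓ) (k : ℕ) :
    (compoundPoisson t q k).toReal = compoundPoissonCoeff t f k := by
  rw [compoundPoisson, PMF.bind_apply, tsum_eq_sum (s := Finset.range (k + 1)), ENNReal.toReal_sum,
    compoundPoissonCoeff]
  · refine Finset.sum_congr rfl fun j _ => ?_
    rw [ENNReal.toReal_mul, toReal_iidSumLaw q hq f hf, Measure.toPMF_apply,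
      poissonMeasure_singleton, ENNReal.toReal_ofReal (by positivity)]
  · intro s _
    exact ENNReal.mul_ne_top (PMF.apply_ne_top _ _) (PMF.apply_ne_top _ _)
  · intro j hj
    have h1 : (iidSumLaw q j k).toReal = 0 := by
      rw [toReal_iidSumLaw q hq f hf]
      exact coeff_clusterSeries_pow_eq_zero f (by simpa using hj)
    rw [ENNReal.toReal_eq_zero_iff] at h1
    rw [h1.resolve_right (PMF.apply_ne_top _ _), mul_zero]

end CompoundPoissonSeries

/-! ### From independence after a gap to independence of consecutive blocks -/

section Mixing

variable {Ω : Type*} [MeasurableSpace Ω] {μ : Measure Ω} [IsProbabilityMeasure μ]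

theorem abs_measureReal_sub_le {X X' B : Set Ω} (h₁ : X ⊆ X' ∪ B) (h₂ : X' ⊆ X ∪ B) :
    |μ.real X - μ.real X'| ≤ μ.real B := by
  have h3 : μ.real X ≤ μ.real X' + μ.real B :=
    (measureReal_mono h₁ (measure_ne_top _ _)).trans (measureReal_union_le _ _)
  have h4 : μ.real X' ≤ μ.real X + μ.real B :=
    (measureReal_mono h₂ (measure_ne_top _ _)).trans (measureReal_union_le _ _)
  rw [abs_le]
  constructor <;> linarith

variable {T : Ω → Ω} {U : Set Ω}

/-- Independence of a block and the future after a gap of length `D` passes to independence of the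
block and its immediate future, up to the probability of a hit in the gap. -/
theorem abs_cov_hitCount_le (hT : MeasurePreserving T μ μ) (hU : MeasurableSet U) {L D : ℕ} {κ : ℝ}
    (hmix : ∀ ℓ : ℕ, ∀ E : Set Ω, MeasurableSet E →
      |μ.real ({x | hitCount T U L x = ℓ} ∩ T^[L + D] ⁻¹' E) -
        μ.real {x | hitCount T U L x = ℓ} * μ.real E| ≤ κ) (M ℓ j : ℕ) :
    |μ.real ({x | hitCount T U L x = ℓ} ∩ T^[L] ⁻¹' {x | hitCount T U M x = j}) -
        μ.real {x | hitCount T U L x = ℓ} * μ.real {x | hitCount T U M x = j}| ≤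
      μ.real (hit T U L ∩ T^[L] ⁻¹' hit T U D) + μ.real (hit T U L) * μ.real (hit T U D) + κ := by
  set F := {x | hitCount T U M x = j} with hF
  set E := {x | hitCount T U (M - D) x = j} with hE
  have hFm : MeasurableSet F := measurableSet_hitCount_eq hT.measurable hU _ _
  have hEm : MeasurableSet E := measurableSet_hitCount_eq hT.measurable hU _ _
  have hFE : ∀ x, x ∉ hit T U D → (x ∈ F ↔ T^[D] x ∈ E) := by
    intro x hx
    simp only [hF, hE, mem_ofPred_eq, hitCount_eq_of_notMem_hit hx M]
  have hF' : |μ.real F - μ.real E| ≤ μ.real (hit T U D) := by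
    rw [← measureReal_preimage_iterate hT D hEm]
    refine abs_measureReal_sub_le (fun x hx => ?_) (fun x hx => ?_)
    · by_cases h : x ∈ hit T U D
      · exact Or.inr h
      · exact Or.inl ((hFE x h).1 hx)
    · by_cases h : x ∈ hit T U D
      · exact Or.inr h
      · exact Or.inl ((hFE x h).2 hx)
  -- The gap matters only when it is hit. For events inside `hit T U L` this costs only the
  -- probability of hits in both the block and the gap, which is what makes the error small relative
  -- to `P(Z^L ≥ 1)`.
  have key : ∀ S : Set Ω, S ⊆ hit T U L →
      |μ.real (S ∩ T^[L + D] ⁻¹' E) - μ.real S * μ.real E| ≤ κ →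
      |μ.real (S ∩ T^[L] ⁻¹' F) - μ.real S * μ.real F| ≤
        μ.real (hit T U L ∩ T^[L] ⁻¹' hit T U D) + μ.real (hit T U L) * μ.real (hit T U D) + κ := by
    intro S hS hκ
    have h1 : |μ.real (S ∩ T^[L] ⁻¹' F) - μ.real (S ∩ T^[L + D] ⁻¹' E)| ≤
        μ.real (hit T U L ∩ T^[L] ⁻¹' hit T U D) := by
      have hcomp : ∀ x, T^[L + D] x = T^[D] (T^[L] x) := fun x => by
        rw [add_comm, Function.iterate_add_apply]
      refine abs_measureReal_sub_le ?_ ?_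
      · rintro x ⟨hxS, hx⟩
        by_cases h : T^[L] x ∈ hit T U D
        · exact Or.inr ⟨hS hxS, h⟩
        · refine Or.inl ⟨hxS, ?_⟩
          rw [mem_preimage, hcomp]
          exact (hFE _ h).1 hx
      · rintro x ⟨hxS, hx⟩
        by_cases h : T^[L] x ∈ hit T U D
        · exact Or.inr ⟨hS hxS, h⟩
        · refine Or.inl ⟨hxS, ?_⟩
          rw [mem_preimage, hcomp] at hx
          exact (hFE _ h).2 hx
    have h2 : |μ.real S * μ.real E - μ.real S * μ.real F| ≤
        μ.real (hit T U L) * μ.real (hit T U D) := by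
      rw [← mul_sub, abs_mul, abs_of_nonneg measureReal_nonneg, abs_sub_comm]
      exact mul_le_mul (measureReal_mono hS (measure_ne_top _ _)) hF' (abs_nonneg _)
        measureReal_nonneg
    rw [abs_le] at *
    constructor <;> linarith [h1.1, h1.2, h2.1, h2.2, hκ.1, hκ.2]
  -- The event `ℓ = 0` is not contained in `hit T U L`, but its complement equals that set, and
  -- passing to the complement only changes the sign of a covariance.
  rcases Nat.eq_zero_or_pos ℓ with rfl | hℓ
  · have hV : {x | hitCount T U L x = 0} = (hit T U L)ᶜ := by
      ext x
      exact hitCount_eq_zero_iff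
    have hVm := measurableSet_hit hT.measurable hU L
    have hcompl : ∀ X : Set Ω, μ.real ({x | hitCount T U L x = 0} ∩ X) =
        μ.real X - μ.real (hit T U L ∩ X) := by
      intro X
      have := measureReal_inter_add_sdiff (μ := μ) (s := X) hVm
      rw [hV, inter_comm _ X, inter_comm _ X, ← sdiff_eq]
      linarith
    have hcompl' : μ.real {x | hitCount T U L x = 0} = 1 - μ.real (hit T U L) := by
      rw [hV, probReal_compl_eq_one_sub hVm]
    have h0 := hmix 0 E hEm
    rw [hcompl, hcompl', measureReal_preimage_iterate hT _ hEm] at h0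
    rw [hcompl, hcompl', measureReal_preimage_iterate hT _ hFm]
    have := key _ subset_rfl (by
      rw [abs_le] at *
      constructor <;> linarith [h0.1, h0.2])
    rw [abs_le] at *
    constructor <;> linarith [this.1, this.2]
  · refine key _ (fun x hx => ?_) (hmix ℓ E hEm)
    simp only [mem_ofPred_eq] at hx
    simp only [hit, mem_ofPred_eq, hx]
    exact hℓ

-- The `k + 1` ways to share `k` hits between the block and the future are disjoint; each
-- contributes one covariance error.
open Finset.HasAntidiagonal in
theorem abs_hitCount_add_sub_le (hT : MeasurePreserving T μ μ) (hU : MeasurableSet U) {L D : ℕ}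
    {κ : ℝ} (hmix : ∀ ℓ : ℕ, ∀ E : Set Ω, MeasurableSet E →
      |μ.real ({x | hitCount T U L x = ℓ} ∩ T^[L + D] ⁻¹' E) -
        μ.real {x | hitCount T U L x = ℓ} * μ.real E| ≤ κ) (M k : ℕ) :
    |μ.real {x | hitCount T U (L + M) x = k} - ∑ p ∈ antidiagonal k,
        μ.real {x | hitCount T U L x = p.1} * μ.real {x | hitCount T U M x = p.2}| ≤
      (k + 1) * (μ.real (hit T U L ∩ T^[L] ⁻¹' hit T U D) +
        μ.real (hit T U L) * μ.real (hit T U D) + κ) := by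
  have hm := fun n k => measurableSet_hitCount_eq (U := U) hT.measurable hU n k
  have hsum : μ.real {x | hitCount T U (L + M) x = k} = ∑ p ∈ antidiagonal k,
      μ.real ({x | hitCount T U L x = p.1} ∩ T^[L] ⁻¹' {x | hitCount T U M x = p.2}) := by
    rw [← measureReal_biUnion_finset]
    · congr 1
      ext x
      simp [hitCount_add, Finset.HasAntidiagonal.mem_antidiagonal]
    · intro p _ q _ hpq
      refine disjoint_left.2 fun x hx hx' => hpq ?_
      exact Prod.ext (hx.1.symm.trans hx'.1) (hx.2.symm.trans hx'.2)
    · intro p _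
      exact (hm _ _).inter ((hT.measurable.iterate _) (hm _ _))
  rw [hsum, ← Finset.sum_sub_distrib]
  refine (Finset.abs_sum_le_sum_abs _ _).trans ?_
  refine (Finset.sum_le_card_nsmul _ _ _ fun p _ => abs_cov_hitCount_le hT hU hmix M p.1 p.2).trans ?_
  rw [Finset.Nat.card_antidiagonal, nsmul_eq_mul, Nat.cast_add, Nat.cast_one]

end Mixing

/-! ### Lipschitz approximation of hit events -/

section LipschitzApproximation

variable {Ω : Type*} [MetricSpace Ω]

/-- A Lipschitz function equal to the indicator of the `ρ`-neighbourhood of `Γ` outside the annulus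
of points whose distance to `Γ` lies between `ρ - r` and `ρ`. -/
def bump (Γ : Set Ω) (ρ r : ℝ) (x : Ω) : ℝ := max 0 (min 1 ((ρ - infDist x Γ) / r))

theorem lipschitzWith_bump (Γ : Set Ω) (ρ : ℝ) {r : ℝ≥0} (hr : 0 < r) :
    LipschitzWith r⁻¹ (bump Γ ρ r) := by
  have h : LipschitzWith r⁻¹ fun x => (ρ - infDist x Γ) / r := by
    refine LipschitzWith.of_dist_le_mul fun x y => ?_
    have := (lipschitz_infDist_pt Γ).dist_le_mul x y
    rw [Real.dist_eq] at this ⊢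
    rw [← sub_div, abs_div, sub_sub_sub_cancel_left, abs_sub_comm, NNReal.abs_eq, NNReal.coe_inv,
      div_eq_inv_mul]
    refine mul_le_mul_of_nonneg_left ?_ (by positivity)
    simpa using this
  exact (h.const_min 1).const_max 0

theorem bump_eq_indicator {Γ : Set Ω} (hΓ : Γ.Nonempty) {ρ r : ℝ} (hr : 0 < r) {x : Ω}
    (hx : x ∉ thickening (ρ + r) Γ \ thickening (ρ - r) Γ) :
    bump Γ ρ r x = (thickening ρ Γ).indicator 1 x := by
  simp only [Set.mem_sdiff, mem_thickening_iff_infDist_lt hΓ, not_and, not_not] at hx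
  by_cases h : x ∈ thickening ρ Γ
  · rw [indicator_of_mem h]
    rw [mem_thickening_iff_infDist_lt hΓ] at h
    have := hx (by linarith)
    have h1 : 1 ≤ (ρ - infDist x Γ) / r := by
      rw [le_div_iff₀ hr]
      linarith
    simp [bump, h1]
  · rw [indicator_of_notMem h]
    rw [mem_thickening_iff_infDist_lt hΓ, not_lt] at h
    have h1 : (ρ - infDist x Γ) / r ≤ 0 := div_nonpos_of_nonpos_of_nonneg (by linarith) hr.le
    simp [bump, h1]

theorem lipschitzWith_birkhoff_sum {T : Ω → Ω} {a b : ℝ≥0} (hT : LipschitzWith a T) {f : Ω → ℝ}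
    (hf : LipschitzWith b f) (L : ℕ) :
    LipschitzWith (b * ∑ i ∈ Finset.range L, a ^ i) fun x => ∑ i ∈ Finset.range L, f (T^[i] x) := by
  induction L with
  | zero => simp
  | succ L ih =>
    simp only [Finset.sum_range_succ, mul_add]
    exact ih.add (hf.comp (hT.iterate L))

variable [MeasurableSpace Ω] [BorelSpace Ω] {μ : Measure Ω} [IsProbabilityMeasure μ] {T : Ω → Ω}

/-- Decay of correlations for the events `{Z^L = ℓ}`. -/
theorem abs_cov_hitCount_eq_le {a : ℝ≥0} (hTL : LipschitzWith a T) (hT : MeasurePreserving T μ μ)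
    {𝒞 : ℕ → ℝ} (hI : DecayOfCorrelations μ T 𝒞) {Γ : Set Ω} (hΓ : Γ.Nonempty) {ρ : ℝ} {r : ℝ≥0}
    (hr : 0 < r) (L ℓ n : ℕ) {E : Set Ω} (hE : MeasurableSet E) :
    |μ.real ({x | hitCount T (thickening ρ Γ) L x = ℓ} ∩ T^[n] ⁻¹' E) -
        μ.real {x | hitCount T (thickening ρ Γ) L x = ℓ} * μ.real E| ≤
      2 * (L * μ.real (thickening (ρ + r) Γ \ thickening (ρ - r) Γ)) +
        𝒞 n * (1 + (r : ℝ)⁻¹ * ∑ i ∈ Finset.range L, (a : ℝ) ^ i) := by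
  set U := thickening ρ Γ with hUdef
  have hU : MeasurableSet U := isOpen_thickening.measurableSet
  set S := {x | hitCount T U L x = ℓ} with hSdef
  have hS : MeasurableSet S := measurableSet_hitCount_eq hT.measurable hU L ℓ
  set A := thickening (ρ + r) Γ \ thickening (ρ - r) Γ with hA
  have hAm : MeasurableSet A := isOpen_thickening.measurableSet.diff isOpen_thickening.measurableSet
  set B := ⋃ i ∈ Finset.range L, T^[i] ⁻¹' A with hB
  have hBm : MeasurableSet B := Finset.measurableSet_biUnion _ fun i _ =>
    (hT.measurable.iterate i) hAm
  have hBle : μ.real B ≤ L * μ.real A := by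
    refine (measureReal_biUnion_finset_le _ _).trans ?_
    simp [measureReal_preimage_iterate hT _ hAm]
  set f := bump Γ ρ r
  set s : Ω → ℝ := fun x => ∑ i ∈ Finset.range L, f (T^[i] x) with hs
  -- A tent of height and half-width one centred at `ℓ`: it is Lipschitz in `s` and equals the
  -- indicator of `s = ℓ` at integers. Outside `B` the smoothed count `s` is the integer `hitCount T
  -- U L`.
  set G : Ω → ℝ := fun x => max 0 (1 - |s x - ℓ|) with hG
  have hsL := lipschitzWith_birkhoff_sum hTL (lipschitzWith_bump Γ ρ hr) L
  have hGL : LipschitzWith (r⁻¹ * ∑ i ∈ Finset.range L, a ^ i) G := by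
    have h1 : LipschitzWith 1 fun y : ℝ => 1 - |y - ℓ| := by
      refine LipschitzWith.of_dist_le_mul fun x y => ?_
      rw [Real.dist_eq, Real.dist_eq, sub_sub_sub_cancel_left, NNReal.coe_one, one_mul]
      refine (abs_abs_sub_abs_le_abs_sub _ _).trans ?_
      rw [abs_sub_comm]
      simp
    have := (h1.const_max 0).comp hsL
    rw [one_mul] at this
    exact this
  have hG0 : ∀ x, 0 ≤ G x := fun x => le_max_left _ _
  have hG1 : ∀ x, G x ≤ 1 := fun x => max_le zero_le_one (by linarith [abs_nonneg (s x - ℓ)])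
  have hGS : ∀ x, |G x - S.indicator 1 x| ≤ B.indicator 1 x := by
    intro x
    by_cases hx : x ∈ B
    · rw [indicator_of_mem hx, abs_le]
      have h0 : 0 ≤ S.indicator (1 : Ω → ℝ) x := indicator_nonneg (fun _ _ => zero_le_one) _
      have h1 : S.indicator (1 : Ω → ℝ) x ≤ 1 := indicator_le_self' (fun _ _ => zero_le_one) x
      simp only [Pi.one_apply]
      constructor <;> linarith [hG0 x, hG1 x]
    · rw [indicator_of_notMem hx]
      have hsx : s x = hitCount T U L x := by
        simp only [hs, hitCount, Nat.cast_sum]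
        refine Finset.sum_congr rfl fun i hi => ?_
        have : T^[i] x ∉ A := fun h => hx (by
          simp only [hB, mem_iUnion]
          exact ⟨i, hi, h⟩)
        rw [show f (T^[i] x) = _ from bump_eq_indicator hΓ (NNReal.coe_pos.2 hr) this]
        by_cases h : T^[i] x ∈ U <;> simp [← hUdef, h]
      by_cases hxS : x ∈ S
      · have : hitCount T U L x = ℓ := hxS
        simp [hG, hsx, this, hxS]
      · have h1 : (hitCount T U L x : ℤ) - ℓ ≠ 0 := fun h => hxS (by
          simp only [hSdef, mem_ofPred_eq]; omega)
        have h2 : (1 : ℝ) ≤ |(hitCount T U L x : ℝ) - ℓ| := by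
          have := Int.one_le_abs h1
          exact_mod_cast this
        simp only [hG, hsx, indicator_of_notMem hxS]
        rw [max_eq_left (by linarith)]
        simp
  have hGm : Measurable G := hGL.continuous.measurable
  have hGi : Integrable G μ := Integrable.of_bound hGm.aestronglyMeasurable 1
    (ae_of_all _ fun x => by rw [Real.norm_eq_abs, abs_of_nonneg (hG0 x)]; exact hG1 x)
  set H : Ω → ℝ := E.indicator 1 with hH
  have hHm : Measurable H := measurable_one.indicator hE
  have hH0 : ∀ x, 0 ≤ H x := fun x => indicator_nonneg (fun _ _ => zero_le_one) _
  have hH1 : ∀ x, H x ≤ 1 := fun x => indicator_le_self' (fun _ _ => zero_le_one) x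
  have hdec := hI n G H _ 1 1 hGL (fun x => by rw [abs_of_nonneg (hG0 x)]; exact hG1 x)
    hHm.aestronglyMeasurable (ae_of_all _ fun x => by rw [abs_of_nonneg (hH0 x)]; exact hH1 x)
  have hHint : ∫ x, H x ∂μ = μ.real E := by rw [hH, integral_indicator_one hE]
  have hSi : Integrable (S.indicator (1 : Ω → ℝ)) μ := (integrable_const 1).indicator hS
  have hBi : Integrable (B.indicator (1 : Ω → ℝ)) μ := (integrable_const 1).indicator hBm
  have hint : ∀ (φ : Ω → ℝ), Measurable φ → (∀ x, 0 ≤ φ x) → (∀ x, φ x ≤ 1) →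
      |∫ x, G x * φ x ∂μ - ∫ x, S.indicator 1 x * φ x ∂μ| ≤ μ.real B := by
    intro φ hφ h0 h1
    have hb : ∀ᵐ x ∂μ, ‖φ x‖ ≤ 1 := ae_of_all _ fun x => by
      rw [Real.norm_eq_abs, abs_of_nonneg (h0 x)]; exact h1 x
    rw [← integral_sub (hGi.mul_bdd hφ.aestronglyMeasurable hb)
      (hSi.mul_bdd hφ.aestronglyMeasurable hb), ← integral_indicator_one hBm, ← Real.norm_eq_abs]
    refine norm_integral_le_of_norm_le hBi (ae_of_all _ fun x => ?_)
    rw [← sub_mul, Real.norm_eq_abs, abs_mul, abs_of_nonneg (h0 x)]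
    calc _ ≤ |G x - S.indicator 1 x| * 1 := by gcongr; exact h1 x
      _ ≤ _ := by rw [mul_one]; exact hGS x
  have h1 := hint (fun x => H (T^[n] x)) (hHm.comp (hT.measurable.iterate n)) (fun x => hH0 _)
    (fun x => hH1 _)
  have h2 := hint (fun _ => 1) measurable_const (fun _ => zero_le_one) (fun _ => le_rfl)
  have hSE : ∫ x, S.indicator 1 x * H (T^[n] x) ∂μ = μ.real (S ∩ T^[n] ⁻¹' E) := by
    rw [← integral_indicator_one (hS.inter ((hT.measurable.iterate n) hE))]
    refine integral_congr_ae (ae_of_all _ fun x => ?_)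
    simp only [hH, inter_indicator_one, Pi.mul_apply]
    rfl
  simp only [mul_one, integral_indicator_one hS] at h2
  rw [hSE] at h1
  rw [hHint, mul_one] at hdec
  have h3 : |(∫ x, G x ∂μ) * μ.real E - μ.real S * μ.real E| ≤ μ.real B := by
    rw [← sub_mul, abs_mul, abs_of_nonneg (measureReal_nonneg (s := E))]
    calc _ ≤ μ.real B * 1 := mul_le_mul h2 measureReal_le_one measureReal_nonneg measureReal_nonneg
      _ = _ := mul_one _
  push_cast at hdec
  rw [abs_le] at *
  constructor <;> linarith [hdec.1, hdec.2, h1.1, h1.2, h3.1, h3.2]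

end LipschitzApproximation

/-! ### Cylinders: overlap, measurability and distortion -/

/-- A family of non-null sets inside `B` such that each of them meets at most `N` members of the
family is countable with total measure at most `N μ(B)`. -/
theorem countable_and_tsum_le_of_overlap {Ω : Type*} [MeasurableSpace Ω]
    {μ : Measure Ω} [IsFiniteMeasure μ] {S : Set (Set Ω)}
    (hm : ∀ ζ ∈ S, MeasurableSet ζ)
    (h0 : ∀ ζ ∈ S, μ ζ ≠ 0) {N : ℕ} (hN : ∀ ζ ∈ S, {ζ' ∈ S | (ζ ∩ ζ').Nonempty}.encard ≤ N)
    {B : Set Ω} (hB : MeasurableSet B) (hSB : ∀ ζ ∈ S, ζ ⊆ B) :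
    S.Countable ∧ ∑' ζ : S, μ (ζ : S).1 ≤ N * μ B := by
  have hfin : ∀ F : Finset S, ∑ ζ ∈ F, μ (ζ : S).1 ≤ N * μ B := by
    intro F
    -- All members through `x` meet any chosen member through `x`, so there are at most `N` of them.
    have hpt : ∀ x, ∑ ζ ∈ F, (ζ : S).1.indicator (1 : Ω → ℝ≥0∞) x ≤
        B.indicator (fun _ => (N : ℝ≥0∞)) x := by
      classical
      intro x
      by_cases hx : ∃ ζ ∈ F, x ∈ (ζ : S).1
      · obtain ⟨ζ, hζF, hζ⟩ := hx
        rw [indicator_of_mem (hSB ζ ζ.2 hζ)]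
        have h1 : ∑ ζ ∈ F, (ζ : S).1.indicator (1 : Ω → ℝ≥0∞) x =
            (F.filter fun ζ : S => x ∈ (ζ : S).1).card := by
          rw [Finset.card_filter, Nat.cast_sum]
          refine Finset.sum_congr rfl fun ζ' _ => ?_
          by_cases h : x ∈ (ζ' : S).1 <;> simp [h]
        rw [h1]
        have h2 : ((F.filter fun ζ : S => x ∈ (ζ : S).1).card : ℕ∞) ≤ N := by
          refine le_trans ?_ (hN ζ ζ.2)
          have h3 : (((F.filter fun ζ : S => x ∈ (ζ : S).1).image Subtype.val : Finset (Set Ω)) :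
              Set (Set Ω)) ⊆ {ζ' ∈ S | ((ζ : S).1 ∩ ζ').Nonempty} := by
            intro ζ' hζ'
            simp only [Finset.coe_image, Finset.coe_filter, mem_image, mem_ofPred_eq] at hζ'
            obtain ⟨ξ, hξ, rfl⟩ := hζ'
            exact ⟨ξ.2, x, hζ, hξ.2⟩
          have h4 := encard_le_encard h3
          rwa [encard_coe_eq_coe_finsetCard, Finset.card_image_of_injective _
            Subtype.val_injective] at h4
        exact_mod_cast h2
      · push Not at hx
        rw [Finset.sum_eq_zero fun ζ hζ => indicator_of_notMem (hx ζ hζ) _]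
        exact zero_le
    calc ∑ ζ ∈ F, μ (ζ : S).1 = ∑ ζ ∈ F, ∫⁻ x, (ζ : S).1.indicator 1 x ∂μ :=
          Finset.sum_congr rfl fun ζ _ => (lintegral_indicator_one (hm ζ ζ.2)).symm
      _ = ∫⁻ x, ∑ ζ ∈ F, (ζ : S).1.indicator 1 x ∂μ :=
          (lintegral_finsetSum F fun (ζ : S) _ => measurable_one.indicator (hm ζ.1 ζ.2)).symm
      _ ≤ ∫⁻ x, B.indicator (fun _ => (N : ℝ≥0∞)) x ∂μ := lintegral_mono hpt
      _ = N * μ B := by rw [lintegral_indicator hB, setLIntegral_const]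
  have hsum : ∑' ζ : S, μ (ζ : S).1 ≤ N * μ B := by
    rw [ENNReal.tsum_eq_iSup_sum]
    exact iSup_le hfin
  refine ⟨?_, hsum⟩
  have hne : ∑' ζ : S, μ (ζ : S).1 ≠ ∞ :=
    (hsum.trans_lt (ENNReal.mul_lt_top (ENNReal.natCast_lt_top N) (measure_lt_top _ _))).ne
  have hc := Summable.countable_support_ennreal hne
  have : Function.support (fun ζ : S => μ (ζ : S).1) = univ :=
    eq_univ_of_forall fun ζ => h0 ζ ζ.2
  rw [this] at hc
  exact countable_coe_iff.1 (countable_univ_iff.1 hc)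

section CylinderEstimates

variable {Ω : Type*} [MetricSpace Ω] {T : Ω → Ω}

theorem IsInverseBranch.injOn_image {n : ℕ} {B : Set Ω} {ψ : Ω → Ω} (h : IsInverseBranch T n B ψ) :
    InjOn T^[n] (ψ '' B) := by
  rintro _ ⟨x, hx, rfl⟩ _ ⟨y, hy, rfl⟩ hxy
  rw [h.2 x hx, h.2 y hy] at hxy
  rw [hxy]

theorem IsInverseBranch.image_image_inter {n : ℕ} {B : Set Ω} {ψ : Ω → Ω}
    (h : IsInverseBranch T n B ψ) (V : Set Ω) : T^[n] '' (ψ '' B ∩ T^[n] ⁻¹' V) = B ∩ V := by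
  ext x
  constructor
  · rintro ⟨_, ⟨⟨y, hy, rfl⟩, hV⟩, rfl⟩
    rw [mem_preimage, h.2 y hy] at hV
    rw [h.2 y hy]
    exact ⟨hy, hV⟩
  · rintro ⟨hx, hV⟩
    refine ⟨ψ x, ⟨⟨x, hx, rfl⟩, ?_⟩, h.2 x hx⟩
    rwa [mem_preimage, h.2 x hx]

theorem IsInverseBranch.image_subset_preimage {n : ℕ} {B : Set Ω} {ψ : Ω → Ω}
    (h : IsInverseBranch T n B ψ) : ψ '' B ⊆ T^[n] ⁻¹' B := by
  rintro _ ⟨x, hx, rfl⟩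
  rwa [mem_preimage, h.2 x hx]

/-- The image consists of the points of the open set `T⁻ⁿ B` fixed by the continuous map `ψ ∘ Tⁿ`.
It is thus relatively closed in an open set, and neither completeness nor separability is required.
-/
theorem IsInverseBranch.measurableSet_image [MeasurableSpace Ω] [BorelSpace Ω] (hT : Continuous T)
    {n : ℕ} {B : Set Ω} (hB : IsOpen B) {ψ : Ω → Ω} (h : IsInverseBranch T n B ψ) :
    MeasurableSet (ψ '' B) := by
  set W := T^[n] ⁻¹' B
  have hW : IsOpen W := hB.preimage (hT.iterate n)
  have hcont : ContinuousOn (fun x => (ψ (T^[n] x), x)) W :=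
    (h.1.comp (hT.iterate n).continuousOn fun x hx => hx).prodMk continuousOn_id
  have hO := hcont.isOpen_inter_preimage hW (isClosed_diagonal (X := Ω)).isOpen_compl
  have : ψ '' B = W \ (W ∩ (fun x => (ψ (T^[n] x), x)) ⁻¹' (diagonal Ω)ᶜ) := by
    ext x
    simp only [Set.mem_sdiff, mem_inter_iff, mem_preimage, mem_compl_iff, mem_diagonal_iff, not_and,
      not_not]
    constructor
    · rintro ⟨y, hy, rfl⟩
      refine ⟨h.image_subset_preimage ⟨y, hy, rfl⟩, fun _ => by rw [h.2 y hy]⟩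
    · rintro ⟨hx, hx'⟩
      exact ⟨T^[n] x, hx, hx' hx⟩
  rw [this]
  exact hW.measurableSet.diff hO.measurableSet

variable [MeasurableSpace Ω] [BorelSpace Ω] {μ : Measure Ω}

theorem IsInverseBranch.measure_eq_lintegral (hT : Continuous T) {n : ℕ} {J : Ω → ℝ≥0}
    (hJ : IsJacobian μ T^[n] J) {B : Set Ω} (hB : IsOpen B) {ψ : Ω → Ω}
    (h : IsInverseBranch T n B ψ) {V : Set Ω} (hV : MeasurableSet V) :
    μ (B ∩ V) = ∫⁻ x in ψ '' B ∩ T^[n] ⁻¹' V, (J x : ℝ≥0∞) ∂μ := by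
  rw [← h.image_image_inter V]
  refine hJ.2 _ ((h.measurableSet_image hT hB).inter ((hT.iterate n).measurable hV))
    (h.injOn_image.mono inter_subset_left) ?_
  rw [h.image_image_inter V]
  exact hB.measurableSet.inter hV

/-- Bounded distortion: the proportion of a cylinder that is mapped into `V` is controlled by the
proportion of `V` in the image. -/
theorem IsInverseBranch.measure_mul_le (hT : Continuous T) {n : ℕ} {J : Ω → ℝ≥0}
    (hJ : IsJacobian μ T^[n] J) {B : Set Ω} (hB : IsOpen B) {ψ : Ω → Ω}
    (h : IsInverseBranch T n B ψ) {K : ℝ≥0} (hK : ∀ x ∈ ψ '' B, ∀ y ∈ ψ '' B, J x ≤ K * J y)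
    {V : Set Ω} (hV : MeasurableSet V) :
    μ B * μ (ψ '' B ∩ T^[n] ⁻¹' V) ≤ K * μ (ψ '' B) * μ V := by
  have hζ := h.measurableSet_image hT hB
  have hA := hζ.inter ((hT.iterate n).measurable hV)
  -- The measure of `B` is the integral of `J` over the cylinder, where `J ≤ K * J x`. Integrating
  -- this bound over the part mapped into `V` gives the claim.
  have h1 : ∀ x ∈ ψ '' B, μ B ≤ K * μ (ψ '' B) * J x := by
    intro x hx
    have := h.measure_eq_lintegral hT hJ hB MeasurableSet.univ
    rw [inter_univ, preimage_univ, inter_univ] at this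
    rw [this]
    calc _ ≤ ∫⁻ _ in ψ '' B, (K * J x : ℝ≥0∞) ∂μ :=
          setLIntegral_mono' hζ fun y hy => by exact_mod_cast hK y hy x hx
      _ = _ := by
        rw [setLIntegral_const]
        ring
  calc μ B * μ (ψ '' B ∩ T^[n] ⁻¹' V) = ∫⁻ _ in ψ '' B ∩ T^[n] ⁻¹' V, μ B ∂μ := by
        rw [setLIntegral_const]
    _ ≤ ∫⁻ x in ψ '' B ∩ T^[n] ⁻¹' V, K * μ (ψ '' B) * J x ∂μ :=
        setLIntegral_mono' hA fun x hx => h1 x hx.1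
    _ = K * μ (ψ '' B) * μ (B ∩ V) := by
        rw [lintegral_const_mul _ hJ.1.coe_nnreal_ennreal, h.measure_eq_lintegral hT hJ hB hV]
    _ ≤ _ := by gcongr; exact inter_subset_right

/-- Returns of `U` to `V` inside the good cylinders. -/
theorem measure_good_returns_le [IsFiniteMeasure μ] (hTc : Continuous T)
    (hT : MeasurePreserving T μ μ) {n : ℕ} {R : ℝ} {Y : ℕ → Finset Ω} {I : ℕ → Ω → Set (Ω → Ω)}
    (hinv : ∀ y ∈ Y n, ∀ ψ ∈ I n y, IsInverseBranch T n (ball y R) ψ) {N : ℕ}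
    (hN : ∀ ζ ∈ cylinders R Y I n, {ζ' ∈ cylinders R Y I n | (ζ ∩ ζ').Nonempty}.encard ≤ (N : ℕ∞))
    {c : ℝ≥0∞} (hc : ∀ y ∈ Y n, μ (ball y R) ≠ 0 → c ≤ μ (ball y R)) {J : Ω → ℝ≥0}
    (hJ : IsJacobian μ T^[n] J) {𝒢 : Set (Set Ω)} (h𝒢 : 𝒢 ⊆ cylinders R Y I n) {K : ℝ≥0}
    (hK : ∀ ζ ∈ 𝒢, ∀ x ∈ ζ, ∀ y ∈ ζ, J x ≤ K * J y) {U B V : Set Ω} (hB : MeasurableSet B)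
    (hUB : ∀ ζ ∈ 𝒢, (ζ ∩ U).Nonempty → ζ ⊆ B) (hV : MeasurableSet V) :
    c * μ (⋃₀ 𝒢 ∩ U ∩ T^[n] ⁻¹' V) ≤ K * (N * μ B) * μ V := by
  set S := {ζ ∈ 𝒢 | (ζ ∩ U).Nonempty ∧ μ ζ ≠ 0} with hS
  have hSm : ∀ ζ ∈ S, MeasurableSet ζ := by
    intro ζ hζ
    obtain ⟨y, hy, ψ, hψ, rfl⟩ := h𝒢 hζ.1
    exact (hinv y hy ψ hψ).measurableSet_image hTc isOpen_ball
  have hSN : ∀ ζ ∈ S, {ζ' ∈ S | (ζ ∩ ζ').Nonempty}.encard ≤ N := fun ζ hζ =>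
    (encard_le_encard (t := {ζ' ∈ cylinders R Y I n | (ζ ∩ ζ').Nonempty})
      fun ζ' hζ' => ⟨h𝒢 hζ'.1.1, hζ'.2⟩).trans (hN ζ (h𝒢 hζ.1))
  obtain ⟨hcount, hsum⟩ := countable_and_tsum_le_of_overlap hSm (fun ζ hζ => hζ.2.2) hSN hB
    fun ζ hζ => hUB ζ hζ.1 hζ.2.1
  -- There may be uncountably many null cylinders, so they cannot be discarded one at a time. By the
  -- Jacobian identity each lies over a null ball, and there are only finitely many balls, with null
  -- preimages by invariance.
  set Z := ⋃ y ∈ {y ∈ (Y n : Set Ω) | μ (ball y R) = 0}, T^[n] ⁻¹' ball y R with hZ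
  have hZ0 : μ Z = 0 := by
    have hfin : {y ∈ (Y n : Set Ω) | μ (ball y R) = 0}.Countable :=
      ((Y n).finite_toSet.subset fun y hy => hy.1).countable
    refine (measure_biUnion_null_iff hfin).2 fun y hy => ?_
    rw [(hT.iterate n).measure_preimage isOpen_ball.measurableSet.nullMeasurableSet]
    exact hy.2
  have hsub : ⋃₀ 𝒢 ∩ U ∩ T^[n] ⁻¹' V ⊆ (⋃ ζ ∈ S, ζ ∩ T^[n] ⁻¹' V) ∪ Z := by
    rintro x ⟨⟨⟨ζ, hζ, hxζ⟩, hxU⟩, hxV⟩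
    by_cases h0 : μ ζ = 0
    · right
      obtain ⟨y, hy, ψ, hψ, rfl⟩ := h𝒢 hζ
      have hb := hinv y hy ψ hψ
      simp only [hZ, mem_iUnion]
      refine ⟨y, ⟨hy, ?_⟩, hb.image_subset_preimage hxζ⟩
      have := hb.measure_eq_lintegral hTc hJ isOpen_ball MeasurableSet.univ
      rw [inter_univ, preimage_univ, inter_univ] at this
      rw [this]
      exact setLIntegral_measure_zero _ _ h0
    · left
      simp only [mem_iUnion]
      exact ⟨ζ, ⟨hζ, ⟨x, hxζ, hxU⟩, h0⟩, hxζ, hxV⟩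
  have hζle : ∀ ζ : S, c * μ (ζ ∩ T^[n] ⁻¹' V) ≤ K * μ (ζ : Set Ω) * μ V := by
    rintro ⟨ζ, hζ⟩
    obtain ⟨y, hy, ψ, hψ, rfl⟩ := h𝒢 hζ.1
    have hb := hinv y hy ψ hψ
    have h1 := hb.measure_mul_le hTc hJ isOpen_ball (hK _ hζ.1) hV
    refine le_trans ?_ h1
    refine mul_le_mul_left (hc y hy fun h0 => hζ.2.2 ?_) _
    refine measure_mono_null hb.image_subset_preimage ?_
    rwa [(hT.iterate n).measure_preimage isOpen_ball.measurableSet.nullMeasurableSet]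
  calc c * μ (⋃₀ 𝒢 ∩ U ∩ T^[n] ⁻¹' V) ≤ c * μ ((⋃ ζ ∈ S, ζ ∩ T^[n] ⁻¹' V) ∪ Z) := by gcongr
    _ ≤ c * (μ (⋃ ζ ∈ S, ζ ∩ T^[n] ⁻¹' V) + μ Z) := by gcongr; exact measure_union_le _ _
    _ = c * μ (⋃ ζ ∈ S, ζ ∩ T^[n] ⁻¹' V) := by rw [hZ0, add_zero]
    _ ≤ c * ∑' ζ : S, μ (ζ ∩ T^[n] ⁻¹' V) := by
        gcongr
        exact measure_biUnion_le _ hcount _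
    _ = ∑' ζ : S, c * μ (ζ ∩ T^[n] ⁻¹' V) := ENNReal.tsum_mul_left.symm
    _ ≤ ∑' ζ : S, K * μ (ζ : Set Ω) * μ V := ENNReal.tsum_le_tsum hζle
    _ = K * (∑' ζ : S, μ (ζ : Set Ω)) * μ V := by
        rw [ENNReal.tsum_mul_right, ENNReal.tsum_mul_left]
    _ ≤ _ := by gcongr

end CylinderEstimates

/-! ### Correlations of the target with later blocks -/

section ShortCorrelations

variable {Ω : Type*} [MetricSpace Ω] [MeasurableSpace Ω] [BorelSpace Ω] {μ : Measure Ω}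
  [IsProbabilityMeasure μ] {T : Ω → Ω} {Γ : Set Ω}

theorem sum_bad_returns_le {𝒢 : ℕ → Set (Set Ω)} {ρ ε : ℝ} {g : ℕ} (hT : MeasurePreserving T μ μ)
    (h : badReturns μ T Γ 𝒢 ρ g < ENNReal.ofReal ε) (W : ℕ) :
    ∑ n ∈ Finset.Icc g W, μ.real ((⋃₀ 𝒢 n)ᶜ ∩ thickening ρ Γ ∩ T^[n] ⁻¹' hitSet T Γ ρ g) ≤
      ε * μ.real (hitSet T Γ ρ g) := by
  set V := hitSet T Γ ρ g with hV
  have hVm : MeasurableSet V := measurableSet_hit hT.measurable isOpen_thickening.measurableSet g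
  have hle : ∀ n, μ ((⋃₀ 𝒢 n)ᶜ ∩ thickening ρ Γ ∩ T^[n] ⁻¹' V) ≤ μ V := fun n =>
    (measure_mono inter_subset_right).trans_eq
      ((hT.iterate n).measure_preimage hVm.nullMeasurableSet)
  have h1 : ∑ n ∈ Finset.Icc g W, μ ((⋃₀ 𝒢 n)ᶜ ∩ thickening ρ Γ ∩ T^[n] ⁻¹' V) ≤
      badReturns μ T Γ 𝒢 ρ g * μ V := by
    rcases le_or_gt g W with hgW | hgW
    · have h2 : ∑ n ∈ Finset.Icc g W, μ ((⋃₀ 𝒢 n)ᶜ ∩ thickening ρ Γ ∩ T^[n] ⁻¹' V) =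
          ∑ m ∈ Finset.range (W + 1 - g),
            μ ((⋃₀ 𝒢 (g + m))ᶜ ∩ thickening ρ Γ ∩ T^[g + m] ⁻¹' V) := by
        rw [← Finset.sum_Ico_eq_sum_range
          (fun n => μ ((⋃₀ 𝒢 n)ᶜ ∩ thickening ρ Γ ∩ T^[n] ⁻¹' V))]
        rfl
      rw [h2, badReturns, ← ENNReal.tsum_mul_right]
      refine le_trans ?_ (ENNReal.sum_le_tsum (Finset.range (W + 1 - g)))
      refine Finset.sum_le_sum fun m _ => ?_
      -- If `μ V = 0`, cancelling the denominator is still legitimate, because the numerator is at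
      -- most `μ V`.
      rw [ENNReal.div_mul_cancel' (fun h0 => ?_) (fun h0 => absurd h0 (measure_ne_top _ _))]
      exact le_antisymm ((hle _).trans_eq h0) (zero_le)
    · rw [Finset.Icc_eq_empty (by omega)]
      simp
  have hε : 0 < ε := by
    by_contra h0
    rw [ENNReal.ofReal_of_nonpos (not_lt.1 h0)] at h
    exact not_lt_zero h
  have h2 := h1.trans (mul_le_mul_left h.le (μ V))
  have h3 := ENNReal.toReal_mono (ENNReal.mul_ne_top ENNReal.ofReal_ne_top (measure_ne_top _ _)) h2
  rwa [ENNReal.toReal_sum fun _ _ => measure_ne_top _ _, ENNReal.toReal_mul,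
    ENNReal.toReal_ofReal hε.le] at h3

theorem rpow_add_le {a b d : ℝ} (ha : 0 ≤ a) (hb : 0 ≤ b) (hd : 0 ≤ d) :
    (a + b) ^ d ≤ 2 ^ d * (a ^ d + b ^ d) := by
  have hm : 0 ≤ max a b := le_max_of_le_left ha
  calc (a + b) ^ d ≤ (2 * max a b) ^ d := by
        refine Real.rpow_le_rpow (by positivity) ?_ hd
        linarith [le_max_left a b, le_max_right a b]
    _ = 2 ^ d * (max a b) ^ d := Real.mul_rpow zero_le_two hm
    _ ≤ _ := by
        gcongr
        rcases max_cases a b with h | h <;> rw [h.1]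
        · linarith [Real.rpow_nonneg hb d]
        · linarith [Real.rpow_nonneg ha d]

/-- The sums of correlations over the polynomially small contraction rate of the good cylinders. -/
theorem sum_rpow_mul_rpow_le {d d₀ κ C ρ : ℝ} (hd : 0 ≤ d) (hd₀ : 0 < d₀) (hC : 0 ≤ C) (hρ : 0 ≤ ρ)
    {g W : ℕ} (hg : 1 ≤ g) :
    ∑ n ∈ Finset.Icc g W, (n : ℝ) ^ d * (ρ + C * (n : ℝ) ^ (-κ)) ^ d₀ ≤
      2 ^ d₀ * ((W : ℝ) ^ (1 + d) * ρ ^ d₀ +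
        C ^ d₀ * ∑ n ∈ Finset.Icc g W, (n : ℝ) ^ (d - κ * d₀)) := by
  have h1 : ∀ n ∈ Finset.Icc g W, (n : ℝ) ^ d * (ρ + C * (n : ℝ) ^ (-κ)) ^ d₀ ≤
      2 ^ d₀ * ((W : ℝ) ^ d * ρ ^ d₀) + 2 ^ d₀ * (C ^ d₀ * (n : ℝ) ^ (d - κ * d₀)) := by
    intro n hn
    have hn' := Finset.mem_Icc.1 hn
    have hn0 : (0 : ℝ) < n := by exact_mod_cast (by omega : 0 < n)
    calc (n : ℝ) ^ d * (ρ + C * (n : ℝ) ^ (-κ)) ^ d₀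
        ≤ (n : ℝ) ^ d * (2 ^ d₀ * (ρ ^ d₀ + (C * (n : ℝ) ^ (-κ)) ^ d₀)) := by
          gcongr
          exact rpow_add_le hρ (by positivity) hd₀.le
      _ = 2 ^ d₀ * ((n : ℝ) ^ d * ρ ^ d₀) + 2 ^ d₀ * (C ^ d₀ * (n : ℝ) ^ (d - κ * d₀)) := by
          rw [Real.mul_rpow hC (by positivity), ← Real.rpow_mul hn0.le, sub_eq_add_neg,
            Real.rpow_add hn0, neg_mul]
          ring
      _ ≤ _ := by
          gcongr
          exact hn'.2
  refine (Finset.sum_le_sum h1).trans ?_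
  rw [Finset.sum_add_distrib, Finset.sum_const, ← Finset.mul_sum, ← Finset.mul_sum, nsmul_eq_mul,
    mul_add]
  gcongr ?_ + _
  have hcard : ((Finset.Icc g W).card : ℝ) ≤ W := by
    rw [Nat.card_Icc]
    exact_mod_cast (by omega : W + 1 - g ≤ W)
  rcases Nat.eq_zero_or_pos W with rfl | hW
  · rw [Finset.Icc_eq_empty (by omega)]
    simp only [Finset.card_empty, Nat.cast_zero, zero_mul]
    positivity
  have hW0 : (0 : ℝ) < W := by exact_mod_cast hW
  calc ((Finset.Icc g W).card : ℝ) * (2 ^ d₀ * ((W : ℝ) ^ d * ρ ^ d₀))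
      ≤ W * (2 ^ d₀ * ((W : ℝ) ^ d * ρ ^ d₀)) := by gcongr
    _ = _ := by
        rw [Real.rpow_add hW0, Real.rpow_one]
        ring

theorem tendsto_sum_rpow_tail {s : ℝ} (hs : s < -1) {ε : ℝ} (hε : 0 < ε) :
    ∀ᶠ g : ℕ in atTop, ∀ W : ℕ, ∑ n ∈ Finset.Icc g W, (n : ℝ) ^ s ≤ ε := by
  have hsum : Summable fun n : ℕ => (n : ℝ) ^ s := Real.summable_nat_rpow.2 hs
  have htail := tendsto_sum_nat_add fun n : ℕ => (n : ℝ) ^ s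
  filter_upwards [htail.eventually (Iio_mem_nhds hε)] with g hg W
  refine le_trans ?_ (le_of_lt hg)
  have hsum' : Summable fun m : ℕ => ((m + g : ℕ) : ℝ) ^ s := (summable_nat_add_iff g).2 hsum
  have : ∑ n ∈ Finset.Icc g W, (n : ℝ) ^ s =
      ∑ m ∈ Finset.range (W + 1 - g), ((m + g : ℕ) : ℝ) ^ s := by
    have := Finset.sum_Ico_eq_sum_range (fun n : ℕ => (n : ℝ) ^ s) g (W + 1)
    simp only [add_comm g] at this
    exact this
  rw [this]
  exact hsum'.sum_le_tsum _ fun m _ => by positivity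

/-- On bad cylinders this is the bad returns condition. Good `n`-cylinders meeting the target stay
inside its neighbourhood of radius `ρ + C₂ n^(-𝔨)`, so distortion gives terms `n^𝔡 (ρ + C₂
n^(-𝔨))^d₀`. The part with `ρ` sums to order `W^(1+𝔡) ρ^d₀`, small by the choice of `W`; the other
is the tail of a convergent series, since `𝔡 - 𝔨 d₀ < -1`. -/
theorem eventually_short_correlations_le {a : ℝ≥0} (hTL : LipschitzWith a T)
    (hT : MeasurePreserving T μ μ) {R : ℝ} {Y : ℕ → Finset Ω} {I : ℕ → Ω → Set (Ω → Ω)}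
    (hcyl : CylinderSystem μ T R Y I) {J : ℕ → Ω → ℝ≥0}
    (hJ : ∀ n ≥ 1, IsJacobian μ (T^[n]) (J n)) {𝔤 𝔡 𝔨 d₀ d₁ : ℝ} {𝒢 : ℕ → Set (Set Ω)}
    (h𝔡 : 0 ≤ 𝔡) (h𝔨 : 0 < 𝔨) (hII : GoodCylinders μ T Γ (cylinders R Y I) 𝒢 J 𝔤 𝔡 𝔨)
    (hd₀ : 0 < d₀) (hIII : DimensionEstimate μ Γ d₀ d₁) (h𝔨' : (1 + 𝔡) / d₀ < 𝔨) {W : ℝ → ℕ}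
    (hW : Tendsto (fun ρ => (W ρ : ℝ) ^ (1 + 𝔡) * ρ ^ d₀) (𝓝[>] 0) (𝓝 0)) {ε : ℝ} (hε : 0 < ε) :
    ∀ᶠ g : ℕ in atTop, ∀ᶠ ρ : ℝ in 𝓝[>] 0,
      ∑ n ∈ Finset.Icc g (W ρ), μ.real (thickening ρ Γ ∩ T^[n] ⁻¹' hit T (thickening ρ Γ) g) ≤
        ε * μ.real (hit T (thickening ρ Γ) g) := by
  obtain ⟨N, hN⟩ := hcyl.overlap
  obtain ⟨c, hc0, hc⟩ := hcyl.ball_lower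
  -- The lower bound `c` may be infinite (if all balls are null); the minimum with one makes it a
  -- positive real.
  set c' := (min c 1).toReal with hc'
  have hc1 : min c 1 ≠ ∞ := ne_top_of_le_ne_top ENNReal.one_ne_top (min_le_right _ _)
  have hc'0 : 0 < c' := ENNReal.toReal_pos (by simp [hc0.ne']) hc1
  obtain ⟨𝔇, -, h𝔇, C, hC⟩ := hII.distortion
  obtain ⟨δ, hδ, hδd⟩ := hII.contraction
  obtain ⟨C₁, hC₁, h𝔇⟩ := h𝔇.exists_pos
  obtain ⟨C₂, hC₂, hδ⟩ := hδ.exists_pos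
  have hIII' := hIII
  rw [DimensionEstimate, eventually_nhdsWithin_iff, Metric.eventually_nhds_iff] at hIII'
  obtain ⟨ρ₀, hρ₀, hdim⟩ := hIII'
  set A : ℝ := |C| * C₁ * N / c' with hA
  have hA0 : 0 ≤ A := by positivity
  set ε₁ : ℝ := ε / (4 * (A * 2 ^ d₀ * (1 + C₂ ^ d₀) + 1)) with hε₁
  have hε₁0 : 0 < ε₁ := by positivity
  have hexp : 𝔡 - 𝔨 * d₀ < -1 := by
    rw [div_lt_iff₀ hd₀] at h𝔨'
    linarith
  have hbad := hII.bad_returns.eventually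
    (Iio_mem_nhds (ENNReal.ofReal_pos.2 (half_pos hε)))
  -- Ensures that the enlarged radius `ρ + C₂ n^(-𝔨)` stays below `ρ₀`, where the dimension estimate
  -- holds.
  have hg₁ : Tendsto (fun g : ℕ => C₂ * (g : ℝ) ^ (-𝔨)) atTop (𝓝 0) := by
    have := ((tendsto_rpow_neg_atTop h𝔨).comp tendsto_natCast_atTop_atTop).const_mul C₂
    simpa using this
  filter_upwards [hbad, tendsto_sum_rpow_tail hexp hε₁0, eventually_ge_atTop 1,
    eventually_forall_ge_atTop.2 h𝔇.bound, eventually_forall_ge_atTop.2 hδ.bound,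
    eventually_forall_ge_atTop.2 (hg₁.eventually (gt_mem_nhds (half_pos hρ₀)))]
    with g hgbad hgtail hg1 hg𝔇 hgδ hgρ
  filter_upwards [eventually_lt_of_limsup_lt hgbad, hW.eventually (gt_mem_nhds hε₁0),
    self_mem_nhdsWithin, mem_nhdsWithin_of_mem_nhds (gt_mem_nhds (half_pos hρ₀))]
    with ρ hρbad hρW hρ0 hρ1
  have hρ0 : 0 < ρ := hρ0
  set U := thickening ρ Γ with hU
  set V := hit T U g with hV
  have hUm : MeasurableSet U := isOpen_thickening.measurableSet
  have hVm : MeasurableSet V := measurableSet_hit hT.measurable hUm g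
  have hgood : ∀ n ∈ Finset.Icc g (W ρ), μ.real (⋃₀ 𝒢 n ∩ U ∩ T^[n] ⁻¹' V) ≤
      A * μ.real V * ((n : ℝ) ^ 𝔡 * (ρ + C₂ * (n : ℝ) ^ (-𝔨)) ^ d₀) := by
    intro n hn
    have hgn : g ≤ n := (Finset.mem_Icc.1 hn).1
    have hn1 : 1 ≤ n := hg1.trans hgn
    have hn0 : (0 : ℝ) < n := by exact_mod_cast hn1
    set K : ℝ≥0 := Real.toNNReal (|C| * C₁ * (n : ℝ) ^ 𝔡) with hK
    set r := ρ + C₂ * (n : ℝ) ^ (-𝔨) with hr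
    have hr0 : 0 < r := by positivity
    have h𝔇n : |𝔇 n| ≤ C₁ * (n : ℝ) ^ 𝔡 := by
      have := hg𝔇 n hgn
      rwa [Real.norm_eq_abs, Real.norm_eq_abs, abs_of_nonneg (a := (n : ℝ) ^ 𝔡)
        (by positivity)] at this
    have hδn : δ n ≤ C₂ * (n : ℝ) ^ (-𝔨) := by
      have := hgδ n hgn
      rw [Real.norm_eq_abs, Real.norm_eq_abs, abs_of_nonneg (a := (n : ℝ) ^ (-𝔨))
        (by positivity)] at this
      exact (le_abs_self _).trans this
    have hKle : ∀ ζ ∈ 𝒢 n, ∀ x ∈ ζ, ∀ y ∈ ζ, J n x ≤ K * J n y := by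
      intro ζ hζ x hx y hy
      rw [← NNReal.coe_le_coe, NNReal.coe_mul, hK, Real.coe_toNNReal _ (by positivity)]
      refine (hC n hn1 ζ hζ x hx y hy).trans ?_
      refine mul_le_mul_of_nonneg_right ?_ (NNReal.coe_nonneg _)
      calc C * 𝔇 n ≤ |C * 𝔇 n| := le_abs_self _
        _ = |C| * |𝔇 n| := abs_mul _ _
        _ ≤ |C| * (C₁ * (n : ℝ) ^ 𝔡) := by gcongr
        _ = _ := by ring
    have hUB : ∀ ζ ∈ 𝒢 n, (ζ ∩ U).Nonempty → ζ ⊆ thickening r Γ := by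
      rintro ζ hζ ⟨x, hx, hxU⟩ y hy
      obtain ⟨z, hz, hxz⟩ := mem_thickening_iff.1 hxU
      refine mem_thickening_iff.2 ⟨z, hz, ?_⟩
      have := hδd n hn1 ζ hζ y hy x hx
      have := dist_triangle y x z
      linarith
    have h1 := measure_good_returns_le hTL.continuous hT (hcyl.inverseBranch n hn1)
      (hN n hn1) (fun y hy h0 => (min_le_left c 1).trans (hc n hn1 y hy h0)) (hJ n hn1)
      (hII.subset n hn1) hKle isOpen_thickening.measurableSet hUB hVm
    have h2 := ENNReal.toReal_mono (by finiteness) h1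
    simp only [ENNReal.toReal_mul, ENNReal.coe_toReal, ENNReal.toReal_natCast] at h2
    change c' * μ.real _ ≤ K * (N * μ.real _) * μ.real V at h2
    have h3 : μ.real (thickening r Γ) ≤ r ^ d₀ := by
      refine (hdim ?_ hr0).2
      rw [Real.dist_eq, sub_zero, abs_of_pos hr0]
      have := hgρ n hgn
      have hρ1' : ρ < ρ₀ / 2 := hρ1
      linarith
    rw [hK, Real.coe_toNNReal _ (by positivity)] at h2
    have h4 : c' * μ.real (⋃₀ 𝒢 n ∩ U ∩ T^[n] ⁻¹' V) ≤
        |C| * C₁ * (n : ℝ) ^ 𝔡 * (N * r ^ d₀) * μ.real V :=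
      h2.trans (by gcongr)
    rw [mul_comm, ← le_div_iff₀ hc'0] at h4
    refine h4.trans_eq ?_
    rw [hA]
    ring
  have hsplit : ∀ n, μ.real (U ∩ T^[n] ⁻¹' V) ≤ μ.real ((⋃₀ 𝒢 n)ᶜ ∩ U ∩ T^[n] ⁻¹' V) +
      μ.real (⋃₀ 𝒢 n ∩ U ∩ T^[n] ⁻¹' V) := by
    intro n
    refine (measureReal_mono ?_ (measure_ne_top _ _)).trans (measureReal_union_le _ _)
    rintro x ⟨h1, h2⟩
    by_cases h : x ∈ ⋃₀ 𝒢 n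
    · exact Or.inr ⟨⟨h, h1⟩, h2⟩
    · exact Or.inl ⟨⟨h, h1⟩, h2⟩
  have hb := sum_bad_returns_le hT hρbad (W ρ)
  change _ ≤ ε / 2 * μ.real V at hb
  calc _ ≤ ∑ n ∈ Finset.Icc g (W ρ), (μ.real ((⋃₀ 𝒢 n)ᶜ ∩ U ∩ T^[n] ⁻¹' V) +
        A * μ.real V * ((n : ℝ) ^ 𝔡 * (ρ + C₂ * (n : ℝ) ^ (-𝔨)) ^ d₀)) :=
        Finset.sum_le_sum fun n hn => (hsplit n).trans (by gcongr; exact hgood n hn)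
    _ ≤ ε / 2 * μ.real V + A * μ.real V * (2 ^ d₀ * (ε₁ + C₂ ^ d₀ * ε₁)) := by
        rw [Finset.sum_add_distrib, ← Finset.mul_sum]
        refine add_le_add hb ?_
        gcongr
        refine (sum_rpow_mul_rpow_le h𝔡 hd₀ hC₂.le hρ0.le hg1).trans ?_
        gcongr
        exact hgtail _
    _ = (ε / 2 + A * 2 ^ d₀ * (1 + C₂ ^ d₀) * ε₁) * μ.real V := by ring
    _ ≤ ε * μ.real V := by
        gcongr
        set X := A * 2 ^ d₀ * (1 + C₂ ^ d₀) with hX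
        have hX0 : 0 ≤ X := by positivity
        have : X * ε₁ ≤ ε / 2 := by
          rw [hε₁, ← mul_div_assoc, div_le_div_iff₀ (by positivity) two_pos]
          nlinarith
        linarith

end ShortCorrelations

/-! ### Linear growth of hit probabilities and rarity of short returns -/

section ShortReturns

variable {Ω : Type*} [MeasurableSpace Ω] {μ : Measure Ω} [IsProbabilityMeasure μ] {T : Ω → Ω}
  {ι : Type*} {l : Filter ι} {U : ι → Set Ω} {W : ι → ℕ}

/-- One block length `g` is fixed before the limit along `l`, for the tolerance `min ε (1/2)`: the
`1/2` yields linear growth, the `ε` yields rare separated returns up to the long time `W i`. -/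
theorem exists_block_length (hT : MeasurePreserving T μ μ) (hU : ∀ i, MeasurableSet (U i))
    (hW : Tendsto W l atTop)
    (h : ∀ ε > 0, ∀ᶠ g : ℕ in atTop, ∀ᶠ i in l,
      ∑ n ∈ Finset.Icc g (W i), μ.real (U i ∩ T^[n] ⁻¹' hit T (U i) g) ≤
        ε * μ.real (hit T (U i) g)) {ε : ℝ} (hε : 0 < ε) :
    ∃ g ≥ 1, (∀ m : ℕ, ∀ᶠ i in l,
        m / 2 * μ.real (hit T (U i) g) ≤ μ.real (hit T (U i) (2 * g * m))) ∧
      ∀ᶠ i in l, ∀ D, 2 * g + D ≤ W i →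
        μ.real (hit T (U i) g ∩ T^[2 * g] ⁻¹' hit T (U i) D) ≤ ε * μ.real (hit T (U i) g) := by
  obtain ⟨g, hg, hg1⟩ := ((h (min ε (1 / 2)) (by positivity)).and (eventually_ge_atTop 1)).exists
  have hle : ∀ᶠ i in l, ∀ D, 2 * g + D ≤ W i →
      μ.real (hit T (U i) g ∩ T^[2 * g] ⁻¹' hit T (U i) D) ≤
        min ε (1 / 2) * μ.real (hit T (U i) g) := by
    filter_upwards [hg] with i hi D hD
    exact (measureReal_hit_inter_le_sum hT (hU i) hg1 hD).trans hi
  refine ⟨g, hg1, fun m => ?_, ?_⟩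
  · filter_upwards [hle, hW.eventually_ge_atTop (2 * g + 2 * g * m)] with i hi hWi
    refine measureReal_hit_linear_growth hT (hU i) ((hi (2 * g * m) hWi).trans ?_) m le_rfl
    have := min_le_right ε (1 / 2)
    have h0 : 0 ≤ μ.real (hit T (U i) g) := measureReal_nonneg
    nlinarith
  · filter_upwards [hle] with i hi D hD
    refine (hi D hD).trans ?_
    gcongr
    exact min_le_left _ _

/-- The mean cluster size is bounded. -/
theorem exists_mul_measureReal_le (hT : MeasurePreserving T μ μ) (hU : ∀ i, MeasurableSet (U i))
    (hW : Tendsto W l atTop)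
    (h : ∀ ε > 0, ∀ᶠ g : ℕ in atTop, ∀ᶠ i in l,
      ∑ n ∈ Finset.Icc g (W i), μ.real (U i ∩ T^[n] ⁻¹' hit T (U i) g) ≤
        ε * μ.real (hit T (U i) g)) :
    ∃ C : ℝ, ∀ᶠ L : ℕ in atTop, ∀ᶠ i in l, L * μ.real (U i) ≤ C * μ.real (hit T (U i) L) := by
  obtain ⟨g, hg1, hgrow, -⟩ := exists_block_length hT hU hW h one_pos
  refine ⟨8 * g, ?_⟩
  filter_upwards [eventually_ge_atTop (2 * g)] with L hL
  filter_upwards [hgrow (L / (2 * g))] with i hi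
  set m := L / (2 * g) with hm
  have hm1 : 1 ≤ m := by
    rw [hm, Nat.le_div_iff_mul_le (by omega)]
    omega
  have hmL : 2 * g * m ≤ L := Nat.mul_div_le _ _
  have hLm : L ≤ 4 * g * m := by
    have h1 : L < 2 * g * (m + 1) := Nat.lt_mul_div_succ L (by omega)
    nlinarith
  have h1 : μ.real (U i) ≤ μ.real (hit T (U i) g) := measureReal_le_hit T hg1
  have h2 : μ.real (hit T (U i) (2 * g * m)) ≤ μ.real (hit T (U i) L) :=
    measureReal_mono (hit_mono T _ hmL) (measure_ne_top _ _)
  have hLm' : (L : ℝ) ≤ 4 * g * m := by exact_mod_cast hLm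
  calc L * μ.real (U i) ≤ 4 * g * m * μ.real (hit T (U i) g) := by gcongr
    _ = 8 * g * (m / 2 * μ.real (hit T (U i) g)) := by ring
    _ ≤ 8 * g * μ.real (hit T (U i) L) := by gcongr; exact hi.trans h2

/-- After a block with a hit, there is typically no hit within the next `W / 2` steps. -/
theorem eventually_short_returns_le (hT : MeasurePreserving T μ μ) (hU : ∀ i, MeasurableSet (U i))
    (hW : Tendsto W l atTop)
    (h : ∀ ε > 0, ∀ᶠ g : ℕ in atTop, ∀ᶠ i in l,
      ∑ n ∈ Finset.Icc g (W i), μ.real (U i ∩ T^[n] ⁻¹' hit T (U i) g) ≤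
        ε * μ.real (hit T (U i) g)) {ε : ℝ} (hε : 0 < ε) :
    ∀ᶠ L : ℕ in atTop, ∀ᶠ i in l,
      μ.real (hit T (U i) L ∩ T^[L] ⁻¹' hit T (U i) (W i / 2)) ≤ ε * μ.real (hit T (U i) L) := by
  -- With `m = L / (2g)` and `P` the probability of a hit within `g` steps, the target is `2P +
  -- (4m+1)(ε/20)P ≤ ε (m/2) P`. As `m ≥ 1`, the second term is at most `ε m P / 4`, and the first
  -- is too once `ε m ≥ 8`, whence `m₀ ≥ 8/ε`.
  obtain ⟨g, hg1, hgrow, hsep⟩ := exists_block_length hT hU hW h (ε := ε / 20) (by positivity)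
  obtain ⟨m₀, hm₀⟩ := exists_nat_ge (8 / ε)
  filter_upwards [eventually_ge_atTop (2 * g * (m₀ + 1))] with L hL
  filter_upwards [hgrow (L / (2 * g)), hsep, hW.eventually_ge_atTop (2 * (2 * g + L))]
    with i hi hsepi hWi
  set m := L / (2 * g) with hm
  have hm1 : m₀ + 1 ≤ m := by
    rw [hm, Nat.le_div_iff_mul_le (by omega), mul_comm]
    exact hL
  have hmL : 2 * g * m ≤ L := Nat.mul_div_le _ _
  have hLm : L ≤ 4 * m * g := by
    have h1 : L < 2 * g * (m + 1) := Nat.lt_mul_div_succ L (by omega)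
    nlinarith
  have hg0 : (0 : ℝ) < g := by exact_mod_cast hg1
  have hm0 : (1 : ℝ) ≤ m := by exact_mod_cast (by omega : 1 ≤ m)
  have hmε : 8 ≤ ε * m := by
    have : 8 / ε ≤ m := hm₀.trans (by exact_mod_cast (by omega : m₀ ≤ m))
    rwa [div_le_iff₀ hε, mul_comm] at this
  have hLg : (L : ℝ) / g ≤ 4 * m := by
    rw [div_le_iff₀ hg0]
    exact_mod_cast hLm
  have h2 : μ.real (hit T (U i) (2 * g * m)) ≤ μ.real (hit T (U i) L) :=
    measureReal_mono (hit_mono T _ hmL) (measure_ne_top _ _)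
  have h3 := measureReal_hit_inter_next_le (μ := μ) hT (hU i) hg1 L (W i / 2)
  have h4 := hsepi (L + W i / 2) (by omega)
  set P := μ.real (hit T (U i) g)
  set Q := μ.real (hit T (U i) L)
  have hP : 0 ≤ P := measureReal_nonneg
  have hPQ : m / 2 * P ≤ Q := hi.trans h2
  calc _ ≤ _ := h3
    _ ≤ 2 * P + (4 * m + 1) * (ε / 20 * P) := by gcongr
    _ ≤ ε * (m / 2 * P) := by
      have h5 : 0 ≤ (ε * m - 8) * P := mul_nonneg (by linarith) hP
      have h6 : 0 ≤ ε * P * (m - 1) := mul_nonneg (by positivity) (by linarith)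
      nlinarith
    _ ≤ ε * Q := by gcongr

end ShortReturns

/-! ### Approximation by independent blocks -/

section BlockApproximation

open PowerSeries

variable {Ω : Type*} [MeasurableSpace Ω] {μ : Measure Ω} [IsProbabilityMeasure μ] {T : Ω → Ω}

theorem abs_measureReal_hitCount_sub_le (hT : MeasurePreserving T μ μ) {U : Set Ω}
    (hU : MeasurableSet U) {N N' : ℕ} (h : N ≤ N') (k : ℕ) :
    |μ.real {x | hitCount T U N' x = k} - μ.real {x | hitCount T U N x = k}| ≤
      (N' - N) * μ.real U := by
  obtain ⟨d, rfl⟩ := Nat.exists_eq_add_of_le h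
  have hsub : |μ.real {x | hitCount T U (N + d) x = k} - μ.real {x | hitCount T U N x = k}| ≤
      μ.real (T^[N] ⁻¹' hit T U d) := by
    have : ∀ x, T^[N] x ∉ hit T U d → hitCount T U (N + d) x = hitCount T U N x := by
      intro x hx
      rw [hitCount_add, hitCount_eq_zero_iff.2 hx, add_zero]
    refine abs_measureReal_sub_le (fun x hx => ?_) (fun x hx => ?_)
    · by_cases hd : T^[N] x ∈ hit T U d
      · exact Or.inr hd
      · exact Or.inl ((this x hd).symm.trans hx)
    · by_cases hd : T^[N] x ∈ hit T U d
      · exact Or.inr hd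
      · exact Or.inl ((this x hd).trans hx)
  rw [measureReal_preimage_iterate hT _ (measurableSet_hit hT.measurable hU d)] at hsub
  refine hsub.trans ((measureReal_hit_le hT hU d).trans_eq ?_)
  push_cast
  ring

theorem abs_measureReal_hitCount_sub_le_abs (hT : MeasurePreserving T μ μ) {U : Set Ω}
    (hU : MeasurableSet U) (N N' : ℕ) (k : ℕ) :
    |μ.real {x | hitCount T U N' x = k} - μ.real {x | hitCount T U N x = k}| ≤
      |(N' : ℝ) - N| * μ.real U := by
  rcases le_total N N' with h | h
  · refine (abs_measureReal_hitCount_sub_le hT hU h k).trans ?_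
    gcongr
    exact le_abs_self _
  · rw [abs_sub_comm, abs_sub_comm (N' : ℝ)]
    refine (abs_measureReal_hitCount_sub_le hT hU h k).trans ?_
    gcongr
    exact le_abs_self _

theorem measureReal_hitCount_eq_zero (hT : Measurable T) {U : Set Ω} (hU : MeasurableSet U)
    (L : ℕ) : μ.real {x | hitCount T U L x = 0} = 1 - μ.real (hit T U L) := by
  rw [← probReal_compl_eq_one_sub (measurableSet_hit hT hU L)]
  congr 1
  ext x
  exact hitCount_eq_zero_iff

/-- The number of hits in `K` successive blocks is close to a sum of `K` independent copies of the
number of hits in a block. -/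
theorem abs_hitCount_mul_sub_coeff_le (hT : MeasurePreserving T μ μ) {U : Set Ω}
    (hU : MeasurableSet U) {L D : ℕ} {κ : ℝ} (hp : 0 < μ.real (hit T U L))
    (hmix : ∀ ℓ : ℕ, ∀ E : Set Ω, MeasurableSet E →
      |μ.real ({x | hitCount T U L x = ℓ} ∩ T^[L + D] ⁻¹' E) -
        μ.real {x | hitCount T U L x = ℓ} * μ.real E| ≤ κ) (K k : ℕ) :
    |μ.real {x | hitCount T U (K * L) x = k} -
      coeff k ((C (1 - μ.real (hit T U L)) + C (μ.real (hit T U L)) * clusterSeries fun ℓ =>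
        μ.real {x | hitCount T U L x = ℓ} / μ.real (hit T U L)) ^ K)| ≤
      K * ((k + 1) * (μ.real (hit T U L ∩ T^[L] ⁻¹' hit T U D) +
        μ.real (hit T U L) * μ.real (hit T U D) + κ)) := by
  set p := μ.real (hit T U L)
  set φ : ℝ⟦X⟧ := C (1 - p) + C p * clusterSeries fun ℓ =>
        μ.real {x | hitCount T U L x = ℓ} / p with hφdef
  have hφ : ∀ ℓ, coeff ℓ φ = μ.real {x | hitCount T U L x = ℓ} := by
    intro ℓ
    rw [hφdef, map_add, coeff_C_mul, clusterSeries, coeff_mk, coeff_C]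
    split_ifs with h
    · rw [h, measureReal_hitCount_eq_zero hT.measurable hU, mul_zero, add_zero]
    · rw [zero_add, mul_div_cancel₀ _ hp.ne']
  have hκ : 0 ≤ κ := (abs_nonneg _).trans (hmix 0 ∅ MeasurableSet.empty)
  have hη : 0 ≤ μ.real (hit T U L ∩ T^[L] ⁻¹' hit T U D) + p * μ.real (hit T U D) + κ := by
    positivity
  refine abs_sub_coeff_pow_le (k₀ := k) (a := fun m j => μ.real {x | hitCount T U (m * L) x = j})
    (fun ℓ => by rw [hφ]; exact measureReal_nonneg) ?_ (by positivity) ?_ ?_ K le_rfl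
  · simp only [hφ]
    rw [← measureReal_biUnion_finset]
    · exact measureReal_le_one
    · intro i _ j _ hij
      exact disjoint_left.2 fun x hx hx' => hij (hx.symm.trans hx')
    · exact fun i _ => measurableSet_hitCount_eq hT.measurable hU _ _
  · intro j
    by_cases hj : j = 0
    · simp [hj, hitCount]
    · simp [hj, hitCount, Ne.symm hj]
  · intro m j hj
    simp only [hφ]
    -- The new block is put in front of the other `m`. The mixing bound allows any measurable future
    -- event, so the error does not depend on the length of the future.
    rw [Nat.succ_mul, add_comm]
    refine (abs_hitCount_add_sub_le hT hU hmix (m * L) j).trans ?_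
    gcongr

/-- The law of the number of hits until time `t L / P(Z^L ≥ 1)` is close to the compound Poisson
law whose clusters are those of a block of length `L`. -/
theorem eventually_abs_hitCount_sub_compoundPoissonCoeff_le (hT : MeasurePreserving T μ μ)
    {ι : Type*} {l : Filter ι} {U : ι → Set Ω} {D : ι → ℕ} (hU : ∀ i, MeasurableSet (U i))
    (hU0 : ∀ᶠ i in l, 0 < μ.real (U i)) (hUlim : Tendsto (fun i => μ.real (U i)) l (𝓝 0))
    (hD : Tendsto (fun i => D i * μ.real (U i)) l (𝓝 0))
    (hshort : ∀ ε > 0, ∀ᶠ L : ℕ in atTop, ∀ᶠ i in l,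
      μ.real (hit T (U i) L ∩ T^[L] ⁻¹' hit T (U i) (D i)) ≤ ε * μ.real (hit T (U i) L))
    (hmix : ∀ L : ℕ, ∃ κ : ι → ℝ, Tendsto (fun i => κ i / μ.real (U i)) l (𝓝 0) ∧
      ∀ᶠ i in l, ∀ ℓ : ℕ, ∀ E : Set Ω, MeasurableSet E →
        |μ.real ({x | hitCount T (U i) L x = ℓ} ∩ T^[L + D i] ⁻¹' E) -
          μ.real {x | hitCount T (U i) L x = ℓ} * μ.real E| ≤ κ i)
    {lamL : ℕ → ℕ → ℝ} (hlamL : ∀ᶠ L : ℕ in atTop, ∀ ℓ ≥ 1, Tendsto (fun i =>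
      μ.real {x | hitCount T (U i) L x = ℓ} / μ.real (hit T (U i) L)) l (𝓝 (lamL L ℓ)))
    {t : ℝ} (ht : 0 < t) (k : ℕ) {ε : ℝ} (hε : 0 < ε) :
    ∀ᶠ L : ℕ in atTop, ∀ᶠ i in l,
      |μ.real {x | hitCount T (U i) ⌊t * L / μ.real (hit T (U i) L)⌋₊ x = k} -
        compoundPoissonCoeff t (lamL L) k| ≤ ε := by
  -- Each of the three errors per block is at most `ε₁ p`, so the total is at most `K p * 3 (k+1) ε₁
  -- ≤ ε/2`. The remaining `ε/2` is shared by the incomplete last block and the passage from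
  -- compound binomial to compound Poisson.
  set ε₁ := ε / (6 * ((k + 1) * t)) with hε₁
  have hε₁0 : 0 < ε₁ := by positivity
  filter_upwards [hshort ε₁ hε₁0, hlamL, eventually_ge_atTop 1] with L hLshort hLlam hL1
  obtain ⟨κ, hκ0, hκ⟩ := hmix L
  set p : ι → ℝ := fun i => μ.real (hit T (U i) L) with hpdef
  have hL0 : (0 : ℝ) < L := by exact_mod_cast hL1
  have hUp : ∀ i, μ.real (U i) ≤ p i := fun i => measureReal_le_hit T hL1
  have hpU : ∀ i, p i ≤ L * μ.real (U i) := fun i => measureReal_hit_le hT (hU i) L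
  have hplim : Tendsto p l (𝓝 0) := by
    refine squeeze_zero (fun i => measureReal_nonneg) hpU ?_
    simpa using hUlim.const_mul (L : ℝ)
  have hp0 : ∀ᶠ i in l, 0 < p i := hU0.mono fun i hi => hi.trans_le (hUp i)
  have hpwithin : Tendsto p l (𝓝[>] 0) :=
    tendsto_nhdsWithin_iff.2 ⟨hplim, hp0.mono fun i hi => hi⟩
  set K : ι → ℕ := fun i => ⌊t / p i⌋₊ with hK
  have hKtop : Tendsto K l atTop := by
    refine tendsto_nat_floor_atTop.comp ?_
    simpa [div_eq_mul_inv] using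
      (tendsto_inv_nhdsGT_zero.comp hpwithin).const_mul_atTop ht
  have hKle : ∀ᶠ i in l, K i * p i ≤ t := hp0.mono fun i hi => by
    rw [← le_div_iff₀ hi]
    exact Nat.floor_le (by positivity)
  have hKp : Tendsto (fun i => K i * p i) l (𝓝 t) := by
    refine tendsto_of_tendsto_of_tendsto_of_le_of_le' (g := fun i => t - p i) ?_
      tendsto_const_nhds ?_ hKle
    · simpa using hplim.const_sub t
    · filter_upwards [hp0] with i hi
      have := (Nat.lt_floor_add_one (t / p i)).le
      rw [div_le_iff₀ hi] at this
      simp only [hK]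
      linarith
  have hcoeff := tendsto_coeff_binomial_clusterSeries hKtop hKp hLlam k
  have hcoeff' := (Metric.tendsto_nhds.1 hcoeff) (ε / 4) (by positivity)
  have hL' : ∀ᶠ i in l, L * μ.real (U i) < ε / 4 := by
    have := hUlim.const_mul (L : ℝ)
    rw [mul_zero] at this
    exact this.eventually (Iio_mem_nhds (by positivity))
  filter_upwards [hLshort, hκ, hκ0.eventually (Iio_mem_nhds hε₁0), hD.eventually (Iio_mem_nhds hε₁0),
    hU0, hp0, hKle, hcoeff', hL'] with i hs hm hκi hDi hUi hpi hKi hci hLi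
  have h1 := abs_hitCount_mul_sub_coeff_le hT (hU i) hpi hm (K i) k
  rw [Real.dist_eq] at hci
  -- The nested floors agree, so fewer than `L` steps remain after the `K` complete blocks.
  have hN : ⌊t * L / p i⌋₊ / L = K i := by
    rw [← Nat.floor_div_natCast, hK]
    congr 1
    field_simp
  have h2 : |μ.real {x | hitCount T (U i) ⌊t * L / p i⌋₊ x = k} -
      μ.real {x | hitCount T (U i) (K i * L) x = k}| ≤ ε / 4 := by
    have hle : K i * L ≤ ⌊t * L / p i⌋₊ := by
      rw [← hN]
      exact Nat.div_mul_le_self _ _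
    refine (abs_measureReal_hitCount_sub_le hT (hU i) hle k).trans (le_trans ?_ (le_of_lt hLi))
    gcongr
    have : ⌊t * L / p i⌋₊ ≤ L + K i * L := by
      have h3 := Nat.div_add_mod ⌊t * L / p i⌋₊ L
      have h4 := Nat.mod_lt ⌊t * L / p i⌋₊ hL1
      rw [hN, mul_comm] at h3
      omega
    have h5 : ((⌊t * L / p i⌋₊ : ℕ) : ℝ) ≤ L + K i * L := by exact_mod_cast this
    push_cast
    linarith
  have hDp : μ.real (hit T (U i) (D i)) ≤ ε₁ :=
    (measureReal_hit_le hT (hU i) (D i)).trans (le_of_lt hDi)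
  have hκp : κ i ≤ ε₁ * p i := by
    have h3 : κ i / μ.real (U i) < ε₁ := hκi
    rw [div_lt_iff₀ hUi] at h3
    exact h3.le.trans (by gcongr; exact hUp i)
  have h3 : K i * ((k + 1) * (μ.real (hit T (U i) L ∩ T^[L] ⁻¹' hit T (U i) (D i)) +
        p i * μ.real (hit T (U i) (D i)) + κ i)) ≤ ε / 2 := by
    calc _ ≤ K i * ((k + 1) * (ε₁ * p i + p i * ε₁ + ε₁ * p i)) := by gcongr
      _ = (K i * p i) * (3 * ((k + 1) * ε₁)) := by ring
      _ ≤ t * (3 * ((k + 1) * ε₁)) := by gcongr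
      _ = ε / 2 := by
        rw [hε₁]
        field_simp
        norm_num
  have h4 := h1.trans h3
  rw [abs_le] at *
  rw [abs_lt] at hci
  constructor <;> linarith [h2.1, h2.2, h4.1, h4.2, hci.1, hci.2]

end BlockApproximation

/-! ### Cluster sizes and existence of the limits -/

section ClusterSizes

variable {Ω : Type*} [MeasurableSpace Ω] {μ : Measure Ω} [IsProbabilityMeasure μ] {T : Ω → Ω}

theorem sum_measureReal_hitCount_eq (hT : MeasurePreserving T μ μ) {U : Set Ω}
    (hU : MeasurableSet U) (L : ℕ) :
    ∑ ℓ ∈ Finset.Icc 1 L, μ.real {x | hitCount T U L x = ℓ} = μ.real (hit T U L) := by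
  rw [← measureReal_biUnion_finset]
  · congr 1
    ext x
    simp only [mem_iUnion, Finset.mem_Icc, mem_ofPred_eq, exists_prop, exists_eq_right', hit]
    exact ⟨fun h => h.1, fun h => ⟨h, hitCount_le T U L x⟩⟩
  · intro i _ j _ hij
    exact disjoint_left.2 fun x hx hx' => hij (hx.symm.trans hx')
  · exact fun i _ => measurableSet_hitCount_eq hT.measurable hU _ _

theorem sum_mul_measureReal_hitCount_eq (hT : MeasurePreserving T μ μ) {U : Set Ω}
    (hU : MeasurableSet U) (L : ℕ) :
    ∑ ℓ ∈ Finset.Icc 1 L, ℓ * μ.real {x | hitCount T U L x = ℓ} = L * μ.real U := by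
  have h1 : ∫ x, (hitCount T U L x : ℝ) ∂μ = L * μ.real U := by
    have : ∀ x, (hitCount T U L x : ℝ) =
        ∑ j ∈ Finset.range L, (T^[j] ⁻¹' U).indicator (1 : Ω → ℝ) x := by
      intro x
      simp only [hitCount, Nat.cast_sum]
      refine Finset.sum_congr rfl fun j _ => ?_
      by_cases h : T^[j] x ∈ U <;> simp [h]
    simp only [this]
    have hm : ∀ j, MeasurableSet (T^[j] ⁻¹' U) := fun j => (hT.measurable.iterate j) hU
    rw [integral_finsetSum _ fun j _ => (integrable_const 1).indicator (hm j)]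
    simp [integral_indicator_one (hm _), measureReal_preimage_iterate hT _ hU]
  have h2 : ∀ x, (hitCount T U L x : ℝ) = ∑ ℓ ∈ Finset.Icc 1 L,
      ℓ * {x | hitCount T U L x = ℓ}.indicator (1 : Ω → ℝ) x := by
    intro x
    by_cases h0 : hitCount T U L x = 0
    · rw [h0, Finset.sum_eq_zero]
      · simp
      · intro ℓ hℓ
        have hℓ1 := (Finset.mem_Icc.1 hℓ).1
        rw [indicator_of_notMem, mul_zero]
        simp only [mem_ofPred_eq]
        omega
    · rw [Finset.sum_eq_single (hitCount T U L x)]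
      · rw [indicator_of_mem (by simp)]
        simp
      · intro ℓ _ hne
        rw [indicator_of_notMem, mul_zero]
        exact Ne.symm hne
      · intro h
        exact absurd (Finset.mem_Icc.2 ⟨Nat.one_le_iff_ne_zero.2 h0, hitCount_le T U L x⟩) h
  have hm : ∀ ℓ, MeasurableSet {x | hitCount T U L x = ℓ} :=
    fun ℓ => measurableSet_hitCount_eq hT.measurable hU L ℓ
  rw [← h1]
  simp only [h2]
  rw [integral_finsetSum _ fun ℓ _ => ((integrable_const 1).indicator (hm ℓ)).const_mul _]
  refine Finset.sum_congr rfl fun ℓ _ => ?_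
  rw [integral_const_mul, integral_indicator_one (hm ℓ)]

/-- Tightness by Markov's inequality: bounded means leave at most `C/n` of the mass above `n`,
uniformly in `L`, so none is lost in the pointwise limit. -/
theorem hasSum_one_of_tendsto_of_mean_le {f : ℕ → ℕ → ℝ} {lam : ℕ → ℝ} {C : ℝ}
    (hlim : ∀ ℓ ≥ 1, Tendsto (fun L => f L ℓ) atTop (𝓝 (lam ℓ)))
    (h : ∀ᶠ L : ℕ in atTop, (∀ ℓ ≥ 1, 0 ≤ f L ℓ) ∧ ∑ ℓ ∈ Finset.Icc 1 L, f L ℓ = 1 ∧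
      ∑ ℓ ∈ Finset.Icc 1 L, ℓ * f L ℓ ≤ C) :
    (∀ ℓ ≥ 1, 0 ≤ lam ℓ) ∧ HasSum (fun ℓ => lam (ℓ + 1)) 1 := by
  have h0 : ∀ ℓ ≥ 1, 0 ≤ lam ℓ := fun ℓ hℓ =>
    ge_of_tendsto (hlim ℓ hℓ) (h.mono fun L hL => hL.1 ℓ hℓ)
  refine ⟨h0, ?_⟩
  rw [hasSum_iff_tendsto_nat_of_nonneg fun ℓ => h0 _ (by omega)]
  have hS : ∀ n : ℕ, Tendsto (fun L => ∑ ℓ ∈ Finset.Icc 1 n, f L ℓ) atTop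
      (𝓝 (∑ ℓ ∈ Finset.range n, lam (ℓ + 1))) := by
    intro n
    have : ∑ ℓ ∈ Finset.range n, lam (ℓ + 1) = ∑ ℓ ∈ Finset.Icc 1 n, lam ℓ := by
      rw [Finset.range_eq_Ico, Finset.sum_Ico_add' lam 0 n 1]
      rfl
    rw [this]
    exact tendsto_finsetSum _ fun ℓ hℓ => hlim ℓ (Finset.mem_Icc.1 hℓ).1
  have hsplit : ∀ n : ℕ, ∀ᶠ L : ℕ in atTop, 1 - ∑ ℓ ∈ Finset.Icc 1 n, f L ℓ =
      ∑ ℓ ∈ Finset.Ioc n L, f L ℓ := by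
    intro n
    filter_upwards [h, eventually_ge_atTop n] with L hL hnL
    rw [← hL.2.1]
    have : ∀ m, Finset.Icc 1 m = Finset.Ioc 0 m := fun m => by ext; simp [Nat.one_le_iff_ne_zero,
      Nat.pos_iff_ne_zero]
    rw [this, this, ← Finset.sum_Ioc_consecutive _ (Nat.zero_le n) hnL]
    ring
  have hup : ∀ n : ℕ, ∑ ℓ ∈ Finset.range n, lam (ℓ + 1) ≤ 1 := by
    intro n
    refine le_of_tendsto (hS n) ?_
    filter_upwards [h, hsplit n] with L hL hs
    have : 0 ≤ ∑ ℓ ∈ Finset.Ioc n L, f L ℓ := Finset.sum_nonneg fun ℓ hℓ =>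
      hL.1 ℓ (by have := (Finset.mem_Ioc.1 hℓ).1; omega)
    linarith
  have hlow : ∀ n : ℕ, 1 ≤ n → 1 - C / n ≤ ∑ ℓ ∈ Finset.range n, lam (ℓ + 1) := by
    intro n hn
    refine ge_of_tendsto (hS n) ?_
    filter_upwards [h, hsplit n] with L hL hs
    have hn0 : (0 : ℝ) < n := by exact_mod_cast hn
    have h1 : n * ∑ ℓ ∈ Finset.Ioc n L, f L ℓ ≤ C := by
      rw [Finset.mul_sum]
      refine le_trans ?_ hL.2.2
      calc _ ≤ ∑ ℓ ∈ Finset.Ioc n L, ℓ * f L ℓ := by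
            refine Finset.sum_le_sum fun ℓ hℓ => ?_
            have hℓ' := (Finset.mem_Ioc.1 hℓ).1
            exact mul_le_mul_of_nonneg_right (by exact_mod_cast hℓ'.le) (hL.1 ℓ (by omega))
        _ ≤ _ := by
            refine Finset.sum_le_sum_of_subset_of_nonneg (fun ℓ hℓ => ?_) fun ℓ hℓ _ => ?_
            · rw [Finset.mem_Ioc] at hℓ
              exact Finset.mem_Icc.2 ⟨by omega, hℓ.2⟩
            · exact mul_nonneg (Nat.cast_nonneg _) (hL.1 ℓ (Finset.mem_Icc.1 hℓ).1)
    rw [mul_comm, ← le_div_iff₀ hn0] at h1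
    linarith
  refine tendsto_of_tendsto_of_tendsto_of_le_of_le' (g := fun n : ℕ => 1 - C / n) ?_
    tendsto_const_nhds ((eventually_ge_atTop 1).mono hlow) (Eventually.of_forall hup)
  simpa using (tendsto_const_div_atTop_nhds_zero_nat C).const_sub 1

theorem abs_floor_sub_floor_mul_le {x y u : ℝ} (hx : 0 ≤ x) (hy : 0 ≤ y) (hu : 0 < u) :
    |(⌊x⌋₊ : ℝ) - ⌊y⌋₊| * u ≤ |x * u - y * u| + u := by
  have h1 := Nat.floor_le hx
  have h2 := Nat.lt_floor_add_one x
  have h3 := Nat.floor_le hy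
  have h4 := Nat.lt_floor_add_one y
  have h5 : |(⌊x⌋₊ : ℝ) - ⌊y⌋₊| ≤ |x - y| + 1 := by
    rw [abs_le]
    have h6 := neg_abs_le (x - y)
    have h7 := le_abs_self (x - y)
    constructor <;> linarith
  rw [← sub_mul, abs_mul, abs_of_pos hu]
  calc _ ≤ (|x - y| + 1) * u := by gcongr
    _ = _ := by ring

/-- Limit laws for the number of hits, from short return and mixing estimates. -/
theorem compoundPoisson_limit (hT : MeasurePreserving T μ μ)
    {ι : Type*} {l : Filter ι} [NeBot l] {U : ι → Set Ω} {D : ι → ℕ}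
    (hU : ∀ i, MeasurableSet (U i))
    (hU0 : ∀ᶠ i in l, 0 < μ.real (U i)) (hUlim : Tendsto (fun i => μ.real (U i)) l (𝓝 0))
    (hD : Tendsto (fun i => D i * μ.real (U i)) l (𝓝 0))
    (hshort : ∀ ε > 0, ∀ᶠ L : ℕ in atTop, ∀ᶠ i in l,
      μ.real (hit T (U i) L ∩ T^[L] ⁻¹' hit T (U i) (D i)) ≤ ε * μ.real (hit T (U i) L))
    (hmean : ∃ C : ℝ, ∀ᶠ L : ℕ in atTop, ∀ᶠ i in l,
      L * μ.real (U i) ≤ C * μ.real (hit T (U i) L))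
    (hmix : ∀ L : ℕ, ∃ κ : ι → ℝ, Tendsto (fun i => κ i / μ.real (U i)) l (𝓝 0) ∧
      ∀ᶠ i in l, ∀ ℓ : ℕ, ∀ E : Set Ω, MeasurableSet E →
        |μ.real ({x | hitCount T (U i) L x = ℓ} ∩ T^[L + D i] ⁻¹' E) -
          μ.real {x | hitCount T (U i) L x = ℓ} * μ.real E| ≤ κ i)
    {lamL : ℕ → ℕ → ℝ} {lam : ℕ → ℝ} (hlamL : ∀ᶠ L : ℕ in atTop, ∀ ℓ ≥ 1, Tendsto (fun i =>
      μ.real {x | hitCount T (U i) L x = ℓ} / μ.real (hit T (U i) L)) l (𝓝 (lamL L ℓ)))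
    (hlam : ∀ ℓ ≥ 1, Tendsto (fun L => lamL L ℓ) atTop (𝓝 (lam ℓ))) {t : ℝ} (ht : 0 < t) :
    ((∀ ℓ ≥ 1, 0 ≤ lam ℓ) ∧ HasSum (fun ℓ => lam (ℓ + 1)) 1) ∧
    ∃ P : ℕ → ℕ → ℝ,
      (∀ᶠ L : ℕ in atTop, ∀ k : ℕ, Tendsto (fun i =>
        μ.real {x | hitCount T (U i) ⌊t * L / μ.real (hit T (U i) L)⌋₊ x = k}) l (𝓝 (P L k))) ∧
      ∀ k : ℕ, Tendsto (fun L => P L k) atTop (𝓝 (compoundPoissonCoeff t lam k)) := by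
  obtain ⟨C, hC⟩ := hmean
  -- The mean of `λ(L)`. The expected number of hits in a block is `L μ(U)`, so `M L` is the limit
  -- of `L μ(U) / P(Z^L ≥ 1)`, the conversion factor between the two time scales.
  set M : ℕ → ℝ := fun L => ∑ ℓ ∈ Finset.Icc 1 L, ℓ * lamL L ℓ with hM
  have hpos : ∀ L ≥ 1, ∀ᶠ i in l, 0 < μ.real (hit T (U i) L) := fun L hL =>
    hU0.mono fun i hi => hi.trans_le (measureReal_le_hit T hL)
  have hMlim : ∀ᶠ L : ℕ in atTop,
      Tendsto (fun i => L * μ.real (U i) / μ.real (hit T (U i) L)) l (𝓝 (M L)) := by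
    filter_upwards [hlamL] with L hL
    have := tendsto_finsetSum (Finset.Icc 1 L) fun ℓ hℓ =>
      (hL ℓ (Finset.mem_Icc.1 hℓ).1).const_mul (ℓ : ℝ)
    refine this.congr fun i => ?_
    rw [← sum_mul_measureReal_hitCount_eq hT (hU i), Finset.sum_div]
    exact Finset.sum_congr rfl fun ℓ _ => by ring
  have hlamL0 : ∀ᶠ L : ℕ in atTop, ∀ ℓ ≥ 1, 0 ≤ lamL L ℓ := by
    filter_upwards [hlamL] with L hL ℓ hℓ
    exact ge_of_tendsto' (hL ℓ hℓ) fun i => by positivity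
  have hlamL1 : ∀ᶠ L : ℕ in atTop, ∑ ℓ ∈ Finset.Icc 1 L, lamL L ℓ = 1 := by
    filter_upwards [hlamL, eventually_ge_atTop 1] with L hL hL1
    have := tendsto_finsetSum (Finset.Icc 1 L) fun ℓ hℓ => hL ℓ (Finset.mem_Icc.1 hℓ).1
    refine tendsto_nhds_unique this (tendsto_const_nhds.congr' ?_)
    filter_upwards [hpos L hL1] with i hi
    rw [← Finset.sum_div, sum_measureReal_hitCount_eq hT (hU i), div_self hi.ne']
  have hMC : ∀ᶠ L : ℕ in atTop, M L ∈ Icc 1 C := by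
    filter_upwards [hMlim, hC, eventually_ge_atTop 1] with L hL hCL hL1
    refine ⟨ge_of_tendsto hL ?_, le_of_tendsto hL ?_⟩
    · filter_upwards [hpos L hL1] with i hi
      rw [le_div_iff₀ hi, one_mul]
      exact measureReal_hit_le hT (hU i) L
    · filter_upwards [hpos L hL1, hCL] with i hi hi'
      rwa [div_le_iff₀ hi]
  refine ⟨hasSum_one_of_tendsto_of_mean_le hlam (C := C) ?_, ?_⟩
  · filter_upwards [hlamL0, hlamL1, hMC] with L h0 h1 h2
    exact ⟨h0, h1, h2.2⟩
  -- Convergence of `M L` is not known at this point, but its values eventually lie in `[1, C]`. An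
  -- accumulation point along an ultrafilter finer than `atTop` suffices, as all approximations hold
  -- for large `L`.
  obtain ⟨M₀, hM₀, hMM₀⟩ := isCompact_Icc.ultrafilter_le_nhds
    ((Ultrafilter.of (atTop : Filter ℕ)).map M)
    (le_principal_iff.2 (Ultrafilter.of_le atTop hMC))
  have hM₀0 : 0 < M₀ := zero_lt_one.trans_le hM₀.1
  have hof : (Ultrafilter.of (atTop : Filter ℕ) : Filter ℕ) ≤ atTop := Ultrafilter.of_le atTop
  have happrox : ∀ {s : ℝ}, 0 < s → ∀ (k : ℕ) {ε : ℝ}, 0 < ε → _ := fun {s} hs k {ε} hε =>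
    eventually_abs_hitCount_sub_compoundPoissonCoeff_le hT hU hU0 hUlim hD hshort hmix hlamL hs k hε
  -- On the time scale `s / μ(U)`, free of `L`, the law converges: pick one `L` along the
  -- ultrafilter with `M L` close to `M₀`, and compare `s / μ(U)` with `(s / M₀) L / P(Z^L ≥ 1)`.
  -- Two times whose difference multiplied by `μ(U)` is small give close probabilities.
  have hscale : ∀ s > 0, ∀ k : ℕ, Tendsto (fun i =>
      μ.real {x | hitCount T (U i) ⌊s / μ.real (U i)⌋₊ x = k}) l
      (𝓝 (compoundPoissonCoeff (s / M₀) lam k)) := by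
    intro s hs k
    rw [Metric.tendsto_nhds]
    intro ε hε
    have ht' : 0 < s / M₀ := by positivity
    have hcp := (Metric.tendsto_nhds.1
      (tendsto_compoundPoissonCoeff (tendsto_const_nhds (x := s / M₀)) hlam k)) (ε / 4)
      (by positivity)
    have hMs : Tendsto (fun L => |s / M₀ * M L - s|)
        (Ultrafilter.of (atTop : Filter ℕ) : Filter ℕ) (𝓝 0) := by
      have h1 : Tendsto M (Ultrafilter.of (atTop : Filter ℕ) : Filter ℕ) (𝓝 M₀) := hMM₀
      have h2 := ((h1.const_mul (s / M₀)).sub_const s).abs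
      rwa [div_mul_cancel₀ _ hM₀0.ne', sub_self, abs_zero] at h2
    obtain ⟨L, hL1, hL2, hL3, hL4, hL5⟩ :=
      (((happrox ht' k (ε := ε / 4) (by positivity)).filter_mono hof).and
        ((hcp.filter_mono hof).and ((hMlim.filter_mono hof).and
          (((eventually_ge_atTop 1).filter_mono hof).and
            (hMs.eventually (Iio_mem_nhds (show (0 : ℝ) < ε / 4 by positivity))))))).exists
    have h6 : Tendsto (fun i => |s / M₀ * (L * μ.real (U i) / μ.real (hit T (U i) L)) - s| +
        μ.real (U i)) l (𝓝 (|s / M₀ * M L - s| + 0)) :=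
      (((hL3.const_mul (s / M₀)).sub_const s).abs).add hUlim
    rw [add_zero] at h6
    filter_upwards [hL1, h6.eventually (Iio_mem_nhds hL5), hU0, hpos L hL4] with i hi1 hi2 hi3 hi4
    set N := ⌊s / M₀ * L / μ.real (hit T (U i) L)⌋₊ with hN
    set N' := ⌊s / μ.real (U i)⌋₊ with hN'
    have h7 : |(N' : ℝ) - N| * μ.real (U i) ≤ ε / 4 := by
      rw [abs_sub_comm]
      refine (abs_floor_sub_floor_mul_le (by positivity) (by positivity) hi3).trans
        (le_trans (le_of_eq ?_) (le_of_lt hi2))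
      congr 2
      rw [div_mul_cancel₀ _ hi3.ne']
      ring
    have h11 := (abs_measureReal_hitCount_sub_le_abs hT (hU i) N N' k).trans h7
    change |_ - _| < ε / 4 at hL2
    rw [Real.dist_eq, abs_lt]
    rw [abs_le] at hi1 h11
    rw [abs_lt] at hL2
    constructor <;> linarith [hi1.1, hi1.2, h11.1, h11.2, hL2.1, hL2.2]
  -- For fixed `L` the time `t L / P(Z^L ≥ 1)` is asymptotically `t M(L) / μ(U)`, so `hscale` with
  -- `s = t M(L)` gives the inner limit.
  have hfirst : ∀ᶠ L : ℕ in atTop, ∀ k : ℕ, Tendsto (fun i =>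
      μ.real {x | hitCount T (U i) ⌊t * L / μ.real (hit T (U i) L)⌋₊ x = k}) l
      (𝓝 (compoundPoissonCoeff (t * M L / M₀) lam k)) := by
    filter_upwards [hMlim, hMC, eventually_ge_atTop 1] with L hL hLC hL1 k
    have hs : 0 < t * M L := mul_pos ht (zero_lt_one.trans_le hLC.1)
    have h1 := hscale _ hs k
    have h2 : Tendsto (fun i => |t * (L * μ.real (U i) / μ.real (hit T (U i) L)) - t * M L| +
        μ.real (U i)) l (𝓝 0) := by
      have := (((hL.const_mul t).sub_const (t * M L)).abs).add hUlim
      rwa [sub_self, abs_zero, add_zero] at this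
    have h3 : Tendsto (fun i =>
        μ.real {x | hitCount T (U i) ⌊t * L / μ.real (hit T (U i) L)⌋₊ x = k} -
          μ.real {x | hitCount T (U i) ⌊t * M L / μ.real (U i)⌋₊ x = k}) l (𝓝 0) := by
      refine squeeze_zero_norm' ?_ h2
      filter_upwards [hU0, hpos L hL1] with i hi3 hi4
      rw [Real.norm_eq_abs]
      refine (abs_measureReal_hitCount_sub_le_abs hT (hU i) _ _ k).trans ?_
      refine (abs_floor_sub_floor_mul_le (by positivity) (by positivity) hi3).trans_eq ?_
      congr 2
      rw [div_mul_cancel₀ _ hi3.ne']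
      ring
    simpa using h3.add h1
  refine ⟨fun L k => compoundPoissonCoeff (t * M L / M₀) lam k, hfirst, fun k => ?_⟩
  rw [Metric.tendsto_nhds]
  intro ε hε
  have hcp := (Metric.tendsto_nhds.1
    (tendsto_compoundPoissonCoeff (tendsto_const_nhds (x := t)) hlam k)) (ε / 4) (by positivity)
  filter_upwards [hfirst, happrox ht k (ε := ε / 4) (by positivity), hcp] with L h1 h2 h3
  -- The inner limit inherits the block approximation, so the limit in `L` does not require `M L →
  -- M₀`.
  have h4 := le_of_tendsto ((h1 k).sub_const (compoundPoissonCoeff t (lamL L) k)).abs h2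
  rw [Real.dist_eq, abs_lt] at *
  rw [abs_le] at h4
  constructor <;> linarith [h3.1, h3.2, h4.1, h4.2]

end ClusterSizes

/-! ### Choice of exponents and the mixing rate -/

section Parameters

variable {Ω : Type*} [MetricSpace Ω] [MeasurableSpace Ω] {μ : Measure Ω}
  {T : Ω → Ω} {Γ : Set Ω}

theorem tendsto_rpow_nhdsGT_zero {s : ℝ} (hs : 0 < s) :
    Tendsto (fun ρ : ℝ => ρ ^ s) (𝓝[>] 0) (𝓝 0) := by
  have := (Real.continuousAt_rpow_const 0 s (Or.inr hs.le)).tendsto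
  rw [Real.zero_rpow hs.ne'] at this
  exact this.mono_left nhdsWithin_le_nhds

theorem DimensionEstimate.tendsto_zero {d₀ d₁ : ℝ} (hd₀ : 0 < d₀)
    (hIII : DimensionEstimate μ Γ d₀ d₁) :
    Tendsto (fun ρ : ℝ => μ.real (thickening ρ Γ)) (𝓝[>] 0) (𝓝 0) :=
  squeeze_zero' (Eventually.of_forall fun _ => measureReal_nonneg) (hIII.mono fun _ h => h.2)
    (tendsto_rpow_nhdsGT_zero hd₀)

theorem DimensionEstimate.eventually_pos {d₀ d₁ : ℝ} (hIII : DimensionEstimate μ Γ d₀ d₁) :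
    ∀ᶠ ρ : ℝ in 𝓝[>] 0, 0 < μ.real (thickening ρ Γ) := by
  filter_upwards [hIII, self_mem_nhdsWithin] with ρ h hρ
  exact (Real.rpow_pos_of_pos hρ _).trans_le h.1

theorem DimensionEstimate.nonempty {d₀ d₁ : ℝ} (hIII : DimensionEstimate μ Γ d₀ d₁) :
    Γ.Nonempty := by
  obtain ⟨ρ, hρ⟩ := hIII.eventually_pos.exists
  by_contra h
  rw [not_nonempty_iff_eq_empty] at h
  simp [h] at hρ

variable [IsProbabilityMeasure μ]

/-- The annulus condition with `r` close to `ρ` forces `ξ ≤ β`. -/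
theorem AnnulusCondition.exponent_le {d₀ d₁ ξ β : ℝ} (hd₀ : 0 < d₀)
    (hIII : DimensionEstimate μ Γ d₀ d₁) (hξ : 0 < ξ) (hIV : AnnulusCondition μ Γ ξ β) :
    ξ ≤ β := by
  by_contra! hlt
  obtain ⟨C, hC⟩ := hIV
  have h1 : ∀ᶠ ρ : ℝ in 𝓝[>] 0, 1 ≤ |C| * ρ ^ (ξ - β) := by
    filter_upwards [hC, hIII, self_mem_nhdsWithin] with ρ hρC hρd hρ0
    have hρ0 : 0 < ρ := hρ0
    set m := μ.real (thickening ρ Γ) with hm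
    have hm0 : 0 < m := (Real.rpow_pos_of_pos hρ0 _).trans_le hρd.1
    -- Take `r = ρ - s` with `s → 0`: the annulus then contains all of the `ρ`-neighbourhood except
    -- the `s`-neighbourhood, whose measure is at most `s ^ d₀`.
    have h2 : ∀ᶠ s : ℝ in 𝓝[>] 0, m - s ^ d₀ ≤ |C| * ρ ^ (ξ - β) * m := by
      filter_upwards [hIII, self_mem_nhdsWithin,
        mem_nhdsWithin_of_mem_nhds (Iio_mem_nhds hρ0)] with s hs hs0 hsρ
      have hs0 : 0 < s := hs0
      have hsρ : s < ρ := hsρ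
      have h3 := hρC (ρ - s) (by linarith) (by linarith)
      rw [div_le_iff₀ hm0, sub_sub_cancel] at h3
      have h4 : m ≤ μ.real (thickening (ρ + (ρ - s)) Γ \ thickening s Γ) +
          μ.real (thickening s Γ) := by
        refine (measureReal_mono ?_ (measure_ne_top _ _)).trans (measureReal_union_le _ _)
        rw [sdiff_union_self]
        exact subset_union_of_subset_left (thickening_mono (by linarith) Γ) _
      have h5 : C * ((ρ - s) ^ ξ / ρ ^ β) ≤ |C| * ρ ^ (ξ - β) := by
        rw [Real.rpow_sub hρ0]
        have h6 : (ρ - s) ^ ξ ≤ ρ ^ ξ := Real.rpow_le_rpow (by linarith) (by linarith) hξ.le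
        have h7 : 0 ≤ (ρ - s) ^ ξ := Real.rpow_nonneg (by linarith) _
        calc C * ((ρ - s) ^ ξ / ρ ^ β) ≤ |C| * ((ρ - s) ^ ξ / ρ ^ β) := by
              gcongr
              exact le_abs_self C
          _ ≤ _ := by gcongr
      have h8 := mul_le_mul_of_nonneg_right h5 hm0.le
      linarith [hs.2]
    have h9 : Tendsto (fun s : ℝ => m - s ^ d₀) (𝓝[>] 0) (𝓝 m) := by
      simpa using (tendsto_rpow_nhdsGT_zero hd₀).const_sub m
    have h10 := le_of_tendsto h9 h2
    exact le_of_mul_le_mul_right (by linarith) hm0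
  have h2 := (tendsto_rpow_nhdsGT_zero (sub_pos.2 hlt)).const_mul |C|
  rw [mul_zero] at h2
  linarith [ge_of_tendsto h2 h1]

/-- The time horizon will be `ρ^(-v)` and the smoothing width `ρ^w`. The conditions say, in order,
that short correlations are summable up to the horizon, that the annulus is negligible, and that
decay `ρ^(v𝔭)` beats the Lipschitz norm `ρ^(-w)` relative to `μ(U) ≥ ρ^d₁`. -/
theorem exists_exponents {𝔭 𝔡 d₀ d₁ : ℝ} (h𝔡 : 0 ≤ 𝔡) (hd₀ : 0 < d₀) (hd₁ : 0 < d₁)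
    (h : (1 + d₁) * ((1 + 𝔡) / d₀) < 𝔭) :
    ∃ v w : ℝ, 0 < v ∧ v * (1 + 𝔡) < d₀ ∧ 1 < w ∧ d₁ + w < v * 𝔭 := by
  have h𝔭 : 0 < 𝔭 := lt_trans (by positivity) h
  have h1 : (1 + d₁) / 𝔭 < d₀ / (1 + 𝔡) := by
    rw [mul_div_assoc', div_lt_iff₀ hd₀] at h
    rw [div_lt_div_iff₀ h𝔭 (by positivity)]
    linarith
  obtain ⟨v, hv1, hv2⟩ := exists_between h1
  rw [div_lt_iff₀ h𝔭] at hv1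
  rw [lt_div_iff₀ (by positivity)] at hv2
  -- The midpoint of `1` and `v𝔭 - d₁`.
  refine ⟨v, (1 + v * 𝔭 - d₁) / 2, ?_, hv2, by linarith, by linarith⟩
  by_contra! hv
  have := mul_nonpos_of_nonpos_of_nonneg hv h𝔭.le
  linarith

theorem tendsto_floor_rpow_neg {v : ℝ} (hv : 0 < v) :
    Tendsto (fun ρ : ℝ => ⌊ρ ^ (-v)⌋₊) (𝓝[>] 0) atTop := by
  refine tendsto_nat_floor_atTop.comp ?_
  refine (tendsto_inv_nhdsGT_zero.comp (tendsto_nhdsWithin_iff.2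
    ⟨tendsto_rpow_nhdsGT_zero hv, ?_⟩)).congr' ?_
  · filter_upwards [self_mem_nhdsWithin] with ρ hρ using Real.rpow_pos_of_pos hρ _
  · filter_upwards [self_mem_nhdsWithin] with ρ hρ
    rw [Function.comp, Real.rpow_neg (le_of_lt hρ)]

theorem tendsto_floor_rpow_mul_rpow {v s d : ℝ} (hs : 0 ≤ s) (h : v * s < d) :
    Tendsto (fun ρ : ℝ => ((⌊ρ ^ (-v)⌋₊ : ℕ) : ℝ) ^ s * ρ ^ d) (𝓝[>] 0) (𝓝 0) := by
  refine squeeze_zero' ?_ ?_ (tendsto_rpow_nhdsGT_zero (sub_pos.2 h))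
  · filter_upwards [self_mem_nhdsWithin] with ρ hρ
    have hρ : 0 < ρ := hρ
    positivity
  · filter_upwards [self_mem_nhdsWithin] with ρ hρ
    have hρ : 0 < ρ := hρ
    have h1 : ((⌊ρ ^ (-v)⌋₊ : ℕ) : ℝ) ≤ ρ ^ (-v) := Nat.floor_le (by positivity)
    calc _ ≤ (ρ ^ (-v)) ^ s * ρ ^ d := by gcongr
      _ = ρ ^ (d - v * s) := by
        rw [← Real.rpow_mul hρ.le, ← Real.rpow_add hρ]
        congr 1
        ring

/-- The correlation between a block and the future after a polynomially long gap is negligible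
compared to the measure of the target. -/
theorem exists_mixing_rate [BorelSpace Ω] {a : ℝ≥0} (hTL : LipschitzWith a T)
    (hT : MeasurePreserving T μ μ) {𝔭 d₀ d₁ β v w : ℝ} {𝒞 : ℕ → ℝ}
    (hI : DecayOfCorrelations μ T 𝒞) (h𝒞 : 𝒞 =O[atTop] fun k : ℕ => (k : ℝ) ^ (-𝔭))
    (h𝔭 : 0 ≤ 𝔭) (hIII : DimensionEstimate μ Γ d₀ d₁) (hβ : 0 < β) (hIV : AnnulusCondition μ Γ β β)
    (hv : 0 < v) (hw : 1 < w) (hvw : d₁ + w < v * 𝔭) (L : ℕ) :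
    ∃ κ : ℝ → ℝ, Tendsto (fun ρ => κ ρ / μ.real (thickening ρ Γ)) (𝓝[>] 0) (𝓝 0) ∧
      ∀ᶠ ρ in 𝓝[>] 0, ∀ ℓ : ℕ, ∀ E : Set Ω, MeasurableSet E →
        |μ.real ({x | hitCount T (thickening ρ Γ) L x = ℓ} ∩ T^[L + ⌊ρ ^ (-v)⌋₊ / 2] ⁻¹' E) -
          μ.real {x | hitCount T (thickening ρ Γ) L x = ℓ} * μ.real E| ≤ κ ρ := by
  obtain ⟨C, hC⟩ := hIV
  obtain ⟨C₁, hC₁, h𝒞⟩ := h𝒞.exists_pos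
  set A : ℝ := ∑ i ∈ Finset.range L, (a : ℝ) ^ i with hA
  have hA0 : 0 ≤ A := by positivity
  -- The error relative to `μ(U)`: the first term is the annulus of width `ρ^w`, the second the
  -- decay of correlations. The factor `4 ^ 𝔭` arises because the gap is only known to be at least
  -- `ρ^(-v) / 4`, owing to the floor and the halving.
  set F : ℝ → ℝ := fun ρ => 2 * L * |C| * ρ ^ ((w - 1) * β) +
    C₁ * 4 ^ 𝔭 * (1 + A) * ρ ^ (v * 𝔭 - w - d₁) with hF
  have hF0 : Tendsto F (𝓝[>] 0) (𝓝 0) := by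
    have h1 := (tendsto_rpow_nhdsGT_zero (mul_pos (sub_pos.2 hw) hβ)).const_mul (2 * L * |C|)
    have h2 := (tendsto_rpow_nhdsGT_zero (s := v * 𝔭 - w - d₁) (by linarith)).const_mul
      (C₁ * 4 ^ 𝔭 * (1 + A))
    simpa using h1.add h2
  refine ⟨fun ρ => F ρ * μ.real (thickening ρ Γ), hF0.congr' ?_, ?_⟩
  · filter_upwards [hIII.eventually_pos] with ρ hρ
    rw [mul_div_cancel_right₀ _ hρ.ne']
  have hW := tendsto_floor_rpow_neg hv
  have hgap : Tendsto (fun ρ : ℝ => L + ⌊ρ ^ (-v)⌋₊ / 2) (𝓝[>] 0) atTop :=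
    tendsto_atTop_mono (fun ρ => Nat.le_add_left _ _)
      ((Nat.tendsto_div_const_atTop two_ne_zero).comp hW)
  filter_upwards [hC, hgap.eventually h𝒞.bound, hW.eventually_ge_atTop 4, hIII, hIII.eventually_pos,
    self_mem_nhdsWithin, mem_nhdsWithin_of_mem_nhds (Iio_mem_nhds one_pos)]
    with ρ hρC hρ𝒞 hρW hρd hρpos hρ0 hρ1 ℓ E hE
  have hρ0 : 0 < ρ := hρ0
  have hρ1 : ρ < 1 := hρ1
  set r : ℝ≥0 := ⟨ρ ^ w, Real.rpow_nonneg hρ0.le w⟩ with hr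
  have hr0 : 0 < r := Real.rpow_pos_of_pos hρ0 w
  have hrρ : (r : ℝ) < ρ := by
    change ρ ^ w < ρ
    conv_rhs => rw [← Real.rpow_one ρ]
    exact Real.rpow_lt_rpow_of_exponent_gt hρ0 hρ1 hw
  refine (abs_cov_hitCount_eq_le hTL hT hI hIII.nonempty hr0 L ℓ _ hE).trans ?_
  set m := μ.real (thickening ρ Γ)
  set n := L + ⌊ρ ^ (-v)⌋₊ / 2 with hn
  have h1 : μ.real (thickening (ρ + r) Γ \ thickening (ρ - r) Γ) ≤
      |C| * ρ ^ ((w - 1) * β) * m := by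
    have := hρC r hr0 hrρ
    rw [div_le_iff₀ hρpos] at this
    refine this.trans ?_
    gcongr
    · exact le_abs_self C
    · refine le_of_eq ?_
      change (ρ ^ w) ^ β / ρ ^ β = _
      rw [← Real.rpow_mul hρ0.le, ← Real.rpow_sub hρ0]
      congr 1
      ring
  have hn4 : ρ ^ (-v) / 4 ≤ n := by
    have h2 := Nat.lt_floor_add_one (ρ ^ (-v))
    have h3 : ⌊ρ ^ (-v)⌋₊ + 1 ≤ 4 * n := by omega
    have h4 : ((⌊ρ ^ (-v)⌋₊ : ℕ) : ℝ) + 1 ≤ 4 * n := by exact_mod_cast h3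
    linarith
  have h2 : 𝒞 n ≤ C₁ * 4 ^ 𝔭 * ρ ^ (v * 𝔭) := by
    have hv4 : 0 < ρ ^ (-v) / 4 := by positivity
    have h3 : (n : ℝ) ^ (-𝔭) ≤ (ρ ^ (-v) / 4) ^ (-𝔭) :=
      Real.rpow_le_rpow_of_nonpos hv4 hn4 (by linarith)
    have h4 : (ρ ^ (-v) / 4) ^ (-𝔭) = 4 ^ 𝔭 * ρ ^ (v * 𝔭) := by
      rw [Real.div_rpow (by positivity) (by norm_num), ← Real.rpow_mul hρ0.le, neg_mul_neg,
        Real.rpow_neg (by norm_num : (0 : ℝ) ≤ 4), div_inv_eq_mul, mul_comm]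
    rw [h4] at h3
    calc 𝒞 n ≤ ‖𝒞 n‖ := Real.le_norm_self _
      _ ≤ C₁ * ‖(n : ℝ) ^ (-𝔭)‖ := hρ𝒞
      _ = C₁ * (n : ℝ) ^ (-𝔭) := by rw [Real.norm_of_nonneg (by positivity)]
      _ ≤ C₁ * (4 ^ 𝔭 * ρ ^ (v * 𝔭)) := by gcongr
      _ = _ := by ring
  have h3 : 1 + (r : ℝ)⁻¹ * A ≤ (1 + A) * ρ ^ (-w) := by
    have h4 : (1 : ℝ) ≤ ρ ^ (-w) :=
      Real.one_le_rpow_of_pos_of_le_one_of_nonpos hρ0 hρ1.le (by linarith)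
    have h5 : (r : ℝ)⁻¹ = ρ ^ (-w) := (Real.rpow_neg hρ0.le w).symm
    rw [h5]
    linarith
  have h4 : ρ ^ (v * 𝔭) * ρ ^ (-w) ≤ ρ ^ (v * 𝔭 - w - d₁) * m := by
    calc ρ ^ (v * 𝔭) * ρ ^ (-w) = ρ ^ (v * 𝔭 - w - d₁) * ρ ^ d₁ := by
          rw [← Real.rpow_add hρ0, ← Real.rpow_add hρ0]
          congr 1
          ring
      _ ≤ _ := by
        gcongr
        exact hρd.1
  have h5 : 0 ≤ 1 + (r : ℝ)⁻¹ * A := by positivity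
  calc _ ≤ 2 * (L * (|C| * ρ ^ ((w - 1) * β) * m)) +
        C₁ * 4 ^ 𝔭 * ρ ^ (v * 𝔭) * ((1 + A) * ρ ^ (-w)) := by
        gcongr
    _ = 2 * (L * (|C| * ρ ^ ((w - 1) * β) * m)) +
        C₁ * 4 ^ 𝔭 * (1 + A) * (ρ ^ (v * 𝔭) * ρ ^ (-w)) := by ring
    _ ≤ 2 * (L * (|C| * ρ ^ ((w - 1) * β) * m)) +
        C₁ * 4 ^ 𝔭 * (1 + A) * (ρ ^ (v * 𝔭 - w - d₁) * m) := by gcongr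
    _ = F ρ * m := by
      simp only [hF]
      ring

end Parameters

/-! ### The cluster size law and the compound Poisson limit -/

theorem exists_pmf_of_hasSum {lam : ℕ → ℝ} (h0 : ∀ ℓ ≥ 1, 0 ≤ lam ℓ)
    (h1 : HasSum (fun ℓ => lam (ℓ + 1)) 1) :
    ∃ q : PMF ℕ, q 0 = 0 ∧ ∀ ℓ ≥ 1, (q ℓ).toReal = lam ℓ := by
  set f : ℕ → ℝ≥0∞ := fun ℓ => if ℓ = 0 then 0 else ENNReal.ofReal (lam ℓ) with hf
  have hsum : ∑' ℓ, f ℓ = 1 := by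
    rw [tsum_eq_zero_add' ENNReal.summable]
    simp only [hf, if_pos, zero_add, Nat.succ_ne_zero, if_false]
    rw [← ENNReal.ofReal_tsum_of_nonneg (fun ℓ => h0 _ (by omega)) h1.summable, h1.tsum_eq,
      ENNReal.ofReal_one]
  refine ⟨⟨f, ENNReal.summable.hasSum_iff.2 hsum⟩, show f 0 = 0 from if_pos rfl, fun ℓ hℓ => ?_⟩
  change (f ℓ).toReal = lam ℓ
  simp only [hf]
  rw [if_neg (by omega), ENNReal.toReal_ofReal (h0 ℓ hℓ)]

end HitStat

end

theorem theorem1 {Ω : Type*} [MetricSpace Ω] [MeasurableSpace Ω] [BorelSpace Ω]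
    (μ : Measure Ω) [IsProbabilityMeasure μ]
    (T : Ω → Ω) (a : ℝ≥0) (hT : LipschitzWith a T) (hμ : MeasurePreserving T μ μ)
    (R : ℝ) (Y : ℕ → Finset Ω) (I : ℕ → Ω → Set (Ω → Ω))
    (hcyl : HitStat.CylinderSystem μ T R Y I)
    (J : ℕ → Ω → ℝ≥0) (hJ : ∀ n ≥ 1, HitStat.IsJacobian μ (T^[n]) (J n))
    (Γ : Set Ω) (hΓ : μ Γ = 0)
    (𝔭 𝔤 𝔡 𝔨 d₀ d₁ ξ β : ℝ)
    (𝒞 : ℕ → ℝ) (hI : HitStat.DecayOfCorrelations μ T 𝒞)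
    (h𝒞 : 𝒞 =O[atTop] fun k : ℕ => (k : ℝ) ^ (-𝔭))
    (𝒢 : ℕ → Set (Set Ω)) (h𝔤 : 0 < 𝔤) (h𝔡 : 0 ≤ 𝔡) (h𝔨 : 1 < 𝔨)
    (hII : HitStat.GoodCylinders μ T Γ (HitStat.cylinders R Y I) 𝒢 J 𝔤 𝔡 𝔨)
    (hd₀ : 0 < d₀) (hd₁ : d₀ < d₁) (hIII : HitStat.DimensionEstimate μ Γ d₀ d₁)
    (hβ : 0 < β) (hξ : β ≤ ξ) (hIV : HitStat.AnnulusCondition μ Γ ξ β)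
    (h𝔭' : (β / ξ + d₁) * ((1 + 𝔡) / d₀) < 𝔭) (h𝔨' : (1 + 𝔡) / d₀ < 𝔨)
    (lamL : ℕ → ℕ → ℝ) (lam : ℕ → ℝ)
    (hlamL : ∀ᶠ L : ℕ in atTop, ∀ ℓ ≥ 1, Tendsto
      (fun ρ : ℝ => μ.real {x | HitStat.hitCount T (thickening ρ Γ) L x = ℓ} /
        μ.real (HitStat.hitSet T Γ ρ L)) (𝓝[>] 0) (𝓝 (lamL L ℓ)))
    (hlam : ∀ ℓ ≥ 1, Tendsto (fun L => lamL L ℓ) atTop (𝓝 (lam ℓ)))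
    (t : ℝ≥0) (ht : 0 < t) :
    ∃ q : PMF ℕ, q 0 = 0 ∧ (∀ ℓ ≥ 1, (q ℓ).toReal = lam ℓ) ∧
      ∃ P : ℕ → ℕ → ℝ,
        (∀ᶠ L : ℕ in atTop, ∀ k : ℕ, Tendsto
          (fun ρ : ℝ => μ.real {x | HitStat.hitCount T (thickening ρ Γ)
            ⌊(t : ℝ) * L / μ.real (HitStat.hitSet T Γ ρ L)⌋₊ x = k}) (𝓝[>] 0) (𝓝 (P L k))) ∧
        ∀ k : ℕ, Tendsto (fun L => P L k) atTop (𝓝 (HitStat.compoundPoisson t q k).toReal) := by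
  have hξ0 : 0 < ξ := hβ.trans_le hξ
  -- The annulus condition forces equality of the exponents, so `β / ξ = 1` in the hypothesis on
  -- `𝔭`, which becomes the one required by `exists_exponents`.
  obtain rfl : β = ξ := le_antisymm hξ (hIV.exponent_le hd₀ hIII hξ0)
  rw [div_self hβ.ne'] at h𝔭'
  obtain ⟨v, w, hv, hvd, hw, hvw⟩ := HitStat.exists_exponents h𝔡 hd₀ (hd₀.trans hd₁) h𝔭'
  have h𝔭0 : 0 ≤ 𝔭 := by
    by_contra! h
    have := mul_neg_of_pos_of_neg hv h
    linarith
  have hU : ∀ ρ : ℝ, MeasurableSet (thickening ρ Γ) := fun ρ => isOpen_thickening.measurableSet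
  have hW := HitStat.tendsto_floor_rpow_neg hv
  have hcorr : ∀ ε > 0, ∀ᶠ g : ℕ in atTop, ∀ᶠ ρ : ℝ in 𝓝[>] 0,
      ∑ n ∈ Finset.Icc g ⌊ρ ^ (-v)⌋₊,
        μ.real (thickening ρ Γ ∩ T^[n] ⁻¹' HitStat.hit T (thickening ρ Γ) g) ≤
        ε * μ.real (HitStat.hit T (thickening ρ Γ) g) := fun ε hε =>
    HitStat.eventually_short_correlations_le hT hμ hcyl hJ h𝔡 (zero_lt_one.trans h𝔨) hII hd₀ hIII
      h𝔨' (HitStat.tendsto_floor_rpow_mul_rpow (by positivity) hvd) hε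
  -- The gap is long enough for mixing but still short relative to `1 / μ(U)`, so it is rarely hit:
  -- `v ≤ v (1 + 𝔡) < d₀`.
  have hgap : Tendsto (fun ρ : ℝ => ((⌊ρ ^ (-v)⌋₊ / 2 : ℕ) : ℝ) * μ.real (thickening ρ Γ))
      (𝓝[>] 0) (𝓝 0) := by
    have hvd' : v * 1 < d₀ := by
      have := mul_nonneg hv.le h𝔡
      linarith
    refine squeeze_zero' (Eventually.of_forall fun _ => by positivity) ?_
      (HitStat.tendsto_floor_rpow_mul_rpow zero_le_one hvd')
    filter_upwards [hIII] with ρ hρ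
    rw [Real.rpow_one]
    refine mul_le_mul ?_ hρ.2 measureReal_nonneg (Nat.cast_nonneg _)
    exact_mod_cast Nat.div_le_self _ _
  obtain ⟨⟨hlam0, hlam1⟩, P, hP, hPlim⟩ := HitStat.compoundPoisson_limit hμ hU hIII.eventually_pos
    (hIII.tendsto_zero hd₀) hgap
    (fun ε hε => HitStat.eventually_short_returns_le hμ hU hW hcorr hε)
    (HitStat.exists_mul_measureReal_le hμ hU hW hcorr)
    (fun L => HitStat.exists_mixing_rate hT hμ hI h𝒞 h𝔭0 hIII hβ hIV hv hw hvw L)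
    hlamL hlam (t := t) (by exact_mod_cast ht)
  obtain ⟨q, hq0, hq⟩ := HitStat.exists_pmf_of_hasSum hlam0 hlam1
  refine ⟨q, hq0, hq, P, hP, fun k => ?_⟩
  rw [HitStat.toReal_compoundPoisson t q hq0 lam hq]
  exact hPlim k
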